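/- Let $m,n\ge 1$ and let $\mathfrak g=\mathfrak{gl}(m|n)$ over $\mathbb C$, with matrix units $E_{i,j}$ indexed by $I=\{\overline m<\cdots<\overline 1<1<\cdots<n\}$ (barred indices even, unbarred indices odd), $\mathfrak h$ the diagonal matrices and $\mathfrak n^+$ the strictly upper triangular matrices. Let $\delta_m,\dots,\delta_1,\epsilon_1,\dots,\epsilon_n$ be the basis of $\mathfrak h^*$ dual to $E_{\overline m,\overline m},\dots,E_{\overline 1,\overline 1},E_{1,1},\dots,E_{n,n}$, with the bilinear form $(\delta_i,\delta_j)=-(\epsilon_i,\epsilon_j)=\delta_{ij}$ (Kronecker symbol), $(\delta_i,\epsilon_j)=0$, and let $\rho$ be half the sum of the positive even roots minus half the sum of the positive odd roots. For a weight $\lambda\in\mathfrak h^*$ let $M(\lambda)=\mathrm{Ind}_{\mathfrak h\oplus\mathfrak n^+}^{\mathfrak g}\mathbb C_\lambda$ be the Verma module, with highest weight vector $v_\lambda^+$. A vector $v\neq 0$ of a $\mathfrak g$-module is called singular if $\mathfrak n^+v=0$. Theorem. Let $1\le s\le m$, $1\le t\le n$, $\beta=\delta_s-\epsilon_t$, and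 let $\lambda=\sum_{i=1}^m a_i\delta_i+\sum_{j=1}^n b_j\epsilon_j$ be $\beta$-atypical, i.e. $(\lambda+\rho,\beta)=0$ (equivalently, $a_s+b_t+s-t=0$). Put $c_{\overline k}=a_s-a_k+s-k-1$ for $1\le k<s$ and $c_k=b_t-b_k-(t-k)$ for $1\le k<t$. For a subset $J=\{j_1<\cdots<j_p\}$ of $\{k\in I:\overline s<k<t\}$ (possibly empty) put $$E_J=E_{t,j_p}E_{j_p,j_{p-1}}\cdots E_{j_1,\overline s}\quad(E_\emptyset=E_{t,\overline s}),\qquad d_J=\prod_{\overline s<k<t,\ k\notin J}c_k,$$ and let $\mathcal A$ be the set of all such $J$. Then $$S_{-\beta}v_\lambda^+=\sum_{J\in\mathcal A}d_JE_Jv_\lambda^+$$ is a singular vector of weight $\lambda-\beta$ in $M(\lambda)$, and every singular vector of weight $\lambda-\beta$ in $M(\lambda)$ is a nonzero scalar multiple of it. Moreover $\mathrm{Hom}_{\mathfrak g}(M(\lambda-\beta),M(\lambda))\cong\mathbb C$ as complex vector spaces, where $\mathrm{Hom}_{\mathfrak g}$ denotes the space of $U(\mathfrak g)$-linear maps. 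-/

import Mathlib

/-! # The general linear Lie superalgebra `gl(m|n)` over `ℂ`, its Verma modules, and the vector
`S_{-β} v_λ⁺`. -/

namespace GLSuper

/-- The totally ordered index set `m̄ < ⋯ < 2̄ < 1̄ < 1 < 2 < ⋯ < n`. -/
abbrev Idx (m n : ℕ) : Type := (Fin m)ᵒᵈ ⊕ₗ Fin n

/-- The barred index.  As `Fin m` counts from `0`, `bar i` is the paper-style index whose number is
`i + 1`, so that `bar i < bar j` iff `j < i`. -/
def bar {m n : ℕ} (i : Fin m) : Idx m n := toLex (Sum.inl (OrderDual.toDual i))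

/-- The unbarred index (`pos j` carries the number `j + 1`). -/
def pos {m n : ℕ} (j : Fin n) : Idx m n := toLex (Sum.inr j)

/-- Parity of an index: barred indices are even, unbarred ones odd. -/
def par {m n : ℕ} (k : Idx m n) : ZMod 2 := Sum.elim (fun _ => 0) (fun _ => 1) (ofLex k)

/-- The underlying vector space of `gl(m|n)`. -/
abbrev Gl (m n : ℕ) : Type := Matrix (Idx m n) (Idx m n) ℂ

/-- The matrix unit `E_{i,j}`. -/
def unit {m n : ℕ} (i j : Idx m n) : Gl m n := Matrix.single i j 1

/-- The homogeneous component of parity `p` of `gl(m|n)`: `E_{i,j}` has parity `|i| + |j|`. -/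
def homog (m n : ℕ) (p : ZMod 2) : Submodule ℂ (Gl m n) where
  carrier := {A | ∀ i j, par i + par j ≠ p → A i j = 0}
  add_mem' := fun {A B} hA hB i j h => by simp [hA i j h, hB i j h]
  zero_mem' := fun _ _ _ => rfl
  smul_mem' := fun c A hA i j h => by simp [hA i j h]

/-- The sign `(-1)^{pq}`. -/
def sgn (p q : ZMod 2) : ℂ := (-1) ^ (p.val * q.val)

/-- The superbracket `[x, y] = xy - (-1)^{pq} yx` of homogeneous elements `x`, `y` of parities
`p`, `q`. -/
def superBracket {m n : ℕ} (p q : ZMod 2) (x y : Gl m n) : Gl m n := x * y - sgn p q • (y * x)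

/-- The Cartan subalgebra of diagonal matrices. -/
def cartan (m n : ℕ) : Submodule ℂ (Gl m n) where
  carrier := {A | ∀ i j, i ≠ j → A i j = 0}
  add_mem' := fun {A B} hA hB i j h => by simp [hA i j h, hB i j h]
  zero_mem' := fun _ _ _ => rfl
  smul_mem' := fun c A hA i j h => by simp [hA i j h]

/-- `𝔫⁺`: the strictly upper triangular matrices, for the order on `Idx m n`. -/
def nPlus (m n : ℕ) : Submodule ℂ (Gl m n) where
  carrier := {A | ∀ i j, ¬ i < j → A i j = 0}
  add_mem' := fun {A B} hA hB i j h => by simp [hA i j h, hB i j h]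
  zero_mem' := fun _ _ _ => rfl
  smul_mem' := fun c A hA i j h => by simp [hA i j h]

/-- The defining relations `xy - (-1)^{pq} yx = [x, y]` of the enveloping algebra, for `x`, `y`
homogeneous of parities `p`, `q`. -/
inductive Rel (m n : ℕ) :
    TensorAlgebra ℂ (Gl m n) → TensorAlgebra ℂ (Gl m n) → Prop
  | bracket (p q : ZMod 2) (x y : Gl m n) (hx : x ∈ homog m n p) (hy : y ∈ homog m n q) :
      Rel m n
        (TensorAlgebra.ι ℂ x * TensorAlgebra.ι ℂ y -
          sgn p q • (TensorAlgebra.ι ℂ y * TensorAlgebra.ι ℂ x))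
        (TensorAlgebra.ι ℂ (superBracket p q x y))

/-- The universal enveloping algebra `U(gl(m|n))`.  A `gl(m|n)`-module is a module over it. -/
abbrev U (m n : ℕ) : Type := RingQuot (Rel m n)

/-- The canonical map `gl(m|n) → U(gl(m|n))`. -/
noncomputable def ι {m n : ℕ} : Gl m n →ₗ[ℂ] U m n :=
  (RingQuot.mkAlgHom ℂ (Rel m n)).toLinearMap ∘ₗ TensorAlgebra.ι ℂ

/-- Weights, i.e. elements of `𝔥*`, given by their coordinates in the basis `δ_m, …, δ_1, ε_1, …, ε_n`
dual to the diagonal matrix units: `lam (bar i)` is the coefficient `a` of the corresponding `δ`,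
`lam (pos j)` the coefficient `b` of the corresponding `ε`. -/
abbrev Weight (m n : ℕ) : Type := Idx m n → ℂ

/-- The value `λ(h)`. -/
def Weight.eval {m n : ℕ} (lam : Weight m n) (h : Gl m n) : ℂ := ∑ k, lam k * h k k

/-- The basis weight dual to `E_{k,k}`: a `δ` if `k` is barred, an `ε` otherwise. -/
def basisWeight {m n : ℕ} (k : Idx m n) : Weight m n := Pi.single k 1

/-- The bilinear form on `𝔥*` with `(δ_i, δ_j) = -(ε_i, ε_j)` the Kronecker symbol and
`(δ_i, ε_j) = 0`. -/
def form {m n : ℕ} (mu nu : Weight m n) : ℂ :=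
  ∑ i : Fin m, mu (bar i) * nu (bar i) - ∑ j : Fin n, mu (pos j) * nu (pos j)

/-- The Weyl vector: half the sum of the positive even roots minus half the sum of the positive odd
roots.  The positive roots are the differences of the basis weights of `k` and `l`, `k < l`; such a
root is even iff `k` and `l` have the same parity. -/
noncomputable def rho (m n : ℕ) : Weight m n :=
  (1 / 2 : ℂ) •
    (∑ r : Idx m n × Idx m n with r.1 < r.2 ∧ par r.1 = par r.2,
        (basisWeight r.1 - basisWeight r.2)
      - ∑ r : Idx m n × Idx m n with r.1 < r.2 ∧ par r.1 ≠ par r.2,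
        (basisWeight r.1 - basisWeight r.2))

/-- The positive odd root `β = δ_s - ε_t`. -/
def oddRoot {m n : ℕ} (s : Fin m) (t : Fin n) : Weight m n :=
  basisWeight (bar s) - basisWeight (pos t)

/-- `λ` is `β`-atypical: `(λ + ρ, β) = 0`. -/
def IsAtypical {m n : ℕ} (lam beta : Weight m n) : Prop := form (lam + rho m n) beta = 0

/-- A vector is singular if it is non-zero and killed by `𝔫⁺`. -/
def IsSingular (m n : ℕ) {V : Type*} [AddCommGroup V] [Module (U m n) V] (v : V) : Prop :=
  v ≠ 0 ∧ ∀ x ∈ nPlus m n, (ι x : U m n) • v = 0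

/-- `v` lies in the weight space of weight `mu`. -/
def HasWeight {m n : ℕ} {V : Type*} [AddCommGroup V] [Module ℂ V] [Module (U m n) V]
    (mu : Weight m n) (v : V) : Prop :=
  ∀ h ∈ cartan m n, (ι h : U m n) • v = mu.eval h • v

/-- The left ideal of `U(gl(m|n))` generated by `𝔫⁺` and all `h - λ(h)`, `h` diagonal. -/
noncomputable def vermaIdeal {m n : ℕ} (lam : Weight m n) : Submodule (U m n) (U m n) :=
  Submodule.span (U m n)
    ({u | ∃ x ∈ nPlus m n, u = ι x} ∪
      {u | ∃ h ∈ cartan m n, u = ι h - algebraMap ℂ (U m n) (lam.eval h)})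

/-- The Verma module `M(λ)`, the module induced from the one-dimensional `𝔥 ⊕ 𝔫⁺`-module `ℂ 1_λ`,
i.e. the quotient of `U(gl(m|n))` by the left ideal above. -/
abbrev Verma {m n : ℕ} (lam : Weight m n) : Type := U m n ⧸ vermaIdeal lam

/-- The highest weight vector `v_λ⁺ = 1 ⊗ 1_λ`. -/
noncomputable def hwVector {m n : ℕ} (lam : Weight m n) : Verma lam :=
  Submodule.Quotient.mk (1 : U m n)

/-- The scalars `c_k`: for a barred `k` the number `a_s - a_k + (s - k - 1)`, for an unbarred one
`b_t - b_k - (t - k)`. -/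
def coeffC {m n : ℕ} (lam : Weight m n) (s : Fin m) (t : Fin n) (k : Idx m n) : ℂ :=
  Sum.elim
    (fun i : (Fin m)ᵒᵈ =>
      lam (bar s) - lam k + ((s : ℕ) - ((OrderDual.ofDual i : Fin m) : ℕ) - 1))
    (fun j : Fin n => lam (pos t) - lam k - ((t : ℕ) - (j : ℕ)))
    (ofLex k)

/-- The indices `k` with `s̄ < k < t`. -/
def between {m n : ℕ} (s : Fin m) (t : Fin n) : Finset (Idx m n) :=
  {k | bar s < k ∧ k < pos t}

/-- `d_J`, the product of the `c_k` with `s̄ < k < t` and `k ∉ J`. -/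
def coeffD {m n : ℕ} (lam : Weight m n) (s : Fin m) (t : Fin n) (J : Finset (Idx m n)) : ℂ :=
  ∏ k ∈ between s t \ J, coeffC lam s t k

/-- `E_{l,j_p} E_{j_p,j_{p-1}} ⋯ E_{j_1,i}` for the list `[j_1, …, j_p]`; `E_{l,i}` for the empty
list. -/
noncomputable def chain {m n : ℕ} (l : Idx m n) : Idx m n → List (Idx m n) → U m n
  | i, [] => ι (unit l i)
  | i, j :: js => chain l j js * ι (unit j i)

/-- `E_J = E_{t,j_p} E_{j_p,j_{p-1}} ⋯ E_{j_1,s̄}` for `J = {j_1 < ⋯ < j_p}`. -/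
noncomputable def elemE {m n : ℕ} (s : Fin m) (t : Fin n) (J : Finset (Idx m n)) : U m n :=
  chain (pos t) (bar s) (J.sort (· ≤ ·))

/-- `S_{-β} = ∑_J d_J E_J`, the sum over all subsets `J` of `{k | s̄ < k < t}`. -/
noncomputable def elemS {m n : ℕ} (lam : Weight m n) (s : Fin m) (t : Fin n) : U m n :=
  ∑ J ∈ (between s t).powerset, coeffD lam s t J • elemE s t J

end GLSuper

/-! # Singular vectors of weight `λ - β` in Verma modules over `gl(m|n)`

Write `E_{i,j}` (`gen i j`) for the images of the matrix units in `U`, and `v` for the highest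
weight vector. For an index `j > s̄` let `S_j` be the analogue of `S_{-β}` for the chains from `s̄`
to `j` (`partialSum` with target `j`), so that `S_{-β} = S_t`.

*Existence.* If `j'` covers `j`, then `S_{j'} = E_{j',j} S_j + c_j S'_j`, where `S'_j` is `S_j` with
the target of the leftmost factors changed to `j'` (`partialSum_step`). By induction along this
recursion, `S_j v` is killed by every simple raising operator except for `E_{i,j}`, where `j` covers
`i`; that one maps it to `± c_j S_i v` (`raiseRules`). The induction needs one identity between the
`c_k` and the coordinates of `λ` for each pair of neighbours (`IsAdapted`). It holds identically for
neighbours of equal parity, and for the pair `1̄ < 1` it is the atypicality of `λ`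
(`isAdapted_coeffC`). As `c_t = 0`, the vector `S_t v` is killed by `𝔫⁺`.

*A Fock module.* For the rest one has to know that certain vectors of `M(λ)` are independent.
Instead of proving the PBW theorem, the Verma module is mapped to an explicit module. Operators
`Y_{k,i}`, `Z_{k,i}` with the supercommutation relations of creation and annihilation operators give
a representation `E_{k,l} ↦ ∑ᵢ Y_{k,i} Z_{l,i}` (`IsOscillator.relation`). Letting the vacuum be
killed by `Y_{k,i}` for `k < i`, by `Z_{k,i}` for `k > i`, and letting the diagonal modes have
complex exponents, one obtains a highest weight vector of any prescribed weight (`exists_fock_map`). In this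
module a sum `∑_{i<j} E_{j,i} u_i` determines the `u_i` as long as these do not involve the modes
`(·, j)` (`eq_zero_of_sum_fockGen_eq_zero`), which is all of PBW that is used.

*Uniqueness.* The weight space of weight `λ - β` is spanned by chains from `s̄` to `t` applied to
`v` (`mem_chainSpan_of_isWeightVec`). So a vector `w` in it has the form `∑_{i<t} E_{t,i} w_i`
with each `w_i` a combination of chains from `s̄` to `i`. If the simple raising operators kill `w`, then
comparing components shows that the component at the index just before `t` satisfies the same
hypothesis, hence by induction is a multiple of the corresponding partial sum, and that it
determines all other components (`eq_smul_partialVec`). Homomorphisms `M(λ - β) → M(λ)` are the same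
thing as the vectors of weight `λ - β` killed by `𝔫⁺`, which form a line. -/

namespace GLSuper

variable {m n : ℕ}

/-! ### Generators and relations of the enveloping algebra -/

theorem sgn_mul_self (p q : ZMod 2) : sgn p q * sgn p q = 1 := by
  fin_cases p <;> fin_cases q <;> simp [sgn, ZMod.val]

theorem sgn_ne_zero (p q : ZMod 2) : sgn p q ≠ 0 := fun h => by
  simpa [h] using sgn_mul_self p q

/-- The image of the matrix unit `E_{i,j}` in `U(gl(m|n))`. -/
noncomputable def gen (i j : Idx m n) : U m n := ι (unit i j)

/-- The sign `(-1)^{|E_{i,j}| |E_{k,l}|}`. -/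
def genSgn (i j k l : Idx m n) : ℂ := sgn (par i + par j) (par k + par l)

theorem genSgn_ne_zero (i j k l : Idx m n) : genSgn i j k l ≠ 0 := sgn_ne_zero _ _

theorem unit_mem_homog (i j : Idx m n) : unit i j ∈ homog m n (par i + par j) := by
  intro k l h
  rw [unit, Matrix.single_apply_of_ne]
  rintro ⟨rfl, rfl⟩
  exact h rfl

theorem unit_self_mem_cartan (k : Idx m n) : unit k k ∈ cartan m n := fun i j hij => by
  rw [unit, Matrix.single_apply_of_ne]
  rintro ⟨rfl, rfl⟩
  exact hij rfl

theorem ι_mul_ι {p q : ZMod 2} {x y : Gl m n} (hx : x ∈ homog m n p) (hy : y ∈ homog m n q) :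
    ι x * ι y = sgn p q • (ι y * ι x) + ι (superBracket p q x y) := by
  have h := RingQuot.mkAlgHom_rel ℂ (Rel.bracket p q x y hx hy)
  simp only [map_sub, map_mul, map_smul] at h
  rw [← sub_eq_iff_eq_add']
  exact h

theorem gen_mul_gen (i j k l : Idx m n) :
    gen i j * gen k l = genSgn i j k l • (gen k l * gen i j) +
      ((if j = k then gen i l else 0) - genSgn i j k l • (if i = l then gen k j else 0)) := by
  rw [gen, gen, ι_mul_ι (unit_mem_homog i j) (unit_mem_homog k l), superBracket, map_sub, map_smul]
  congr 2
  · split_ifs with h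
    · subst h; simp [unit, gen]
    · simp [unit, h]
  · split_ifs with h
    · subst h; simp [unit, gen, genSgn]
    · simp [unit, Ne.symm h]

theorem gl_eq_sum (x : Gl m n) : x = ∑ i, ∑ j, x i j • unit i j := by
  conv_lhs => rw [Matrix.matrix_eq_sum_single x]
  simp [unit, Matrix.smul_single]

theorem ι_eq_sum (x : Gl m n) : (ι x : U m n) = ∑ i, ∑ j, x i j • gen i j := by
  conv_lhs => rw [gl_eq_sum x]
  simp [gen]

/-- `U(gl(m|n))` is generated by the `E_{i,j}`, in the form of an induction principle for subspaces
of a module. -/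
theorem smul_mem_of_gen_smul_mem {V : Type*} [AddCommGroup V] [Module ℂ V] [Module (U m n) V]
    [IsScalarTower ℂ (U m n) V] {N : Submodule ℂ V}
    (hN : ∀ i j, ∀ x ∈ N, (gen i j : U m n) • x ∈ N) (u : U m n) {x : V} (hx : x ∈ N) :
    u • x ∈ N := by
  obtain ⟨a, rfl⟩ := RingQuot.mkAlgHom_surjective ℂ (Rel m n) u
  induction a using TensorAlgebra.induction generalizing x with
  | algebraMap r =>
    rw [AlgHom.commutes, algebraMap_smul]
    exact N.smul_mem _ hx
  | ι y =>
    change (ι y : U m n) • x ∈ N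
    rw [ι_eq_sum]
    simp only [Finset.sum_smul, smul_assoc]
    exact N.sum_mem fun i _ => N.sum_mem fun j _ => N.smul_mem _ (hN i j x hx)
  | mul a b ha hb => rw [map_mul, mul_smul]; exact ha (hb hx)
  | add a b ha hb => rw [map_add, add_smul]; exact N.add_mem (ha hx) (hb hx)

section Module

variable {V : Type*} [AddCommGroup V] [Module ℂ V] [Module (U m n) V]

/-- The weight equations for the diagonal matrix units. -/
def IsWeightVec (mu : Weight m n) (x : V) : Prop := ∀ k, (gen k k : U m n) • x = mu k • x

theorem HasWeight.isWeightVec {mu : Weight m n} {x : V} (h : HasWeight mu x) :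
    IsWeightVec mu x := by
  intro k
  have := h (unit k k) (unit_self_mem_cartan k)
  rw [gen, this]
  congr 1
  simp [Weight.eval, unit, Matrix.single_apply]

variable [IsScalarTower ℂ (U m n) V]

theorem smul_comm_U (u : U m n) (c : ℂ) (x : V) : u • c • x = c • u • x := by
  rw [← algebraMap_smul (U m n) c x, ← algebraMap_smul (U m n) c (u • x), smul_smul, smul_smul,
    Algebra.commutes]

theorem gen_smul_gen_smul (i j k l : Idx m n) (x : V) :
    gen i j • gen k l • x = genSgn i j k l • gen k l • gen i j • x +
      ((if j = k then gen i l • x else 0) -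
        genSgn i j k l • (if i = l then gen k j • x else 0)) := by
  rw [smul_smul, gen_mul_gen]
  simp only [add_smul, sub_smul, smul_assoc, mul_smul]
  congr 2
  · split_ifs <;> simp
  · split_ifs <;> simp

theorem IsWeightVec.hasWeight {mu : Weight m n} {x : V} (h : IsWeightVec mu x) :
    HasWeight mu x := by
  intro y hy
  rw [ι_eq_sum, Finset.sum_smul, Weight.eval, Finset.sum_smul]
  refine Finset.sum_congr rfl fun i _ => ?_
  rw [Finset.sum_eq_single i (fun j _ hj => by rw [hy i j hj.symm, zero_smul]) (by simp),
    smul_assoc, h i, smul_smul, mul_comm]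

theorem IsWeightVec.gen_smul {mu : Weight m n} {x : V} (h : IsWeightVec mu x) (a b : Idx m n) :
    IsWeightVec (mu + basisWeight a - basisWeight b) ((gen a b : U m n) • x) := by
  intro k
  have h1 : genSgn k k a b = 1 := by
    have : par k + par k = 0 := CharTwo.add_self_eq_zero _
    simp [genSgn, sgn, this]
  rw [gen_smul_gen_smul, h1, h k, smul_comm_U]
  simp only [basisWeight, Pi.add_apply, Pi.sub_apply, Pi.single_apply]
  rcases eq_or_ne k a with rfl | hka <;> rcases eq_or_ne k b with rfl | hkb
  · simp
  · simp [hkb, add_smul, add_comm]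
  · simp [hka, add_smul, sub_eq_add_neg]
  · simp [hka, hkb]

end Module

/-! ### Partial sums of `S_{-β}` and the action of simple raising operators -/

/-- Induction upwards from `s` along covers in a finite linear order. -/
theorem covBy_induction {α : Type*} [LinearOrder α] [Finite α] {s : α} {P : α → Prop}
    (base : P s) (step : ∀ i j, s ≤ i → i ⋖ j → P i → P j) {j : α} (hj : s ≤ j) : P j := by
  induction j using WellFoundedLT.induction with
  | ind j ih =>
    rcases hj.eq_or_lt with rfl | hlt
    · exact base
    · obtain ⟨i, hi, hij⟩ := exists_le_covBy_of_lt hlt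
      exact step i j hi hij (ih i hij.lt hi)

theorem sort_insert_of_forall_lt (J : Finset (Idx m n)) (j : Idx m n)
    (h : ∀ i ∈ J, i < j) : (insert j J).sort (· ≤ ·) = J.sort (· ≤ ·) ++ [j] := by
  have hj : j ∉ J := fun hj => lt_irrefl _ (h j hj)
  apply List.Perm.eq_of_pairwise (le := (· ≤ ·))
  · intro a b _ _ h1 h2; exact le_antisymm h1 h2
  · exact Finset.pairwise_sort _ _
  · rw [List.pairwise_append]
    refine ⟨Finset.pairwise_sort _ _, by simp, ?_⟩
    intro a ha b hb
    rw [List.mem_singleton.1 hb]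
    exact (h a (by simpa using ha)).le
  · rw [List.perm_ext_iff_of_nodup (Finset.sort_nodup _ _)]
    · intro a; simp [or_comm]
    · rw [List.nodup_append]
      refine ⟨Finset.sort_nodup _ _, by simp, ?_⟩
      intro a ha b hb
      rw [List.mem_singleton.1 hb]
      exact (h a (by simpa using ha)).ne

theorem chain_append_singleton (l i j : Idx m n) (js : List (Idx m n)) :
    chain l i (js ++ [j]) = gen l j * chain j i js := by
  induction js generalizing i with
  | nil => rfl
  | cons k ks ih => rw [List.cons_append, chain, ih, chain, mul_assoc]

/-- The partial sum of `S_{-β}` over the chains from `s` to `l` whose intermediate indices are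
below `j`; the coefficients are the products of the `c k` over the skipped indices between `s` and
`j`. -/
noncomputable def partialSum (c : Idx m n → ℂ) (s j l : Idx m n) : U m n :=
  ∑ J ∈ (Finset.univ.filter fun k => s < k ∧ k < j).powerset,
    (∏ k ∈ (Finset.univ.filter fun k => s < k ∧ k < j) \ J, c k) • chain l s (J.sort (· ≤ ·))

theorem partialSum_base (c : Idx m n → ℂ) {s j : Idx m n} (l : Idx m n) (h : s ⋖ j) :
    partialSum c s j l = gen l s := by
  have : (Finset.univ.filter fun k => s < k ∧ k < j) = ∅ := by
    ext k; simpa using fun h1 => not_lt.1 fun h2 => h.2 h1 h2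
  simp [partialSum, this, chain, gen]

/-- Splitting the sum according to whether `j` is skipped or is the last intermediate index. -/
theorem partialSum_step (c : Idx m n → ℂ) {s j j' : Idx m n} (l : Idx m n) (hs : s < j)
    (h : j ⋖ j') :
    partialSum c s j' l = gen l j * partialSum c s j j + c j • partialSum c s j l := by
  set K := Finset.univ.filter fun k => s < k ∧ k < j with hK
  have hj : j ∉ K := by simp [hK]
  have hK' : (Finset.univ.filter fun k => s < k ∧ k < j') = insert j K := by
    ext k
    simp only [hK, Finset.mem_filter, Finset.mem_univ, true_and, Finset.mem_insert]
    constructor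
    · rintro ⟨h1, h2⟩
      rcases (h.le_of_lt h2).eq_or_lt with h3 | h3
      · exact Or.inl h3
      · exact Or.inr ⟨h1, h3⟩
    · rintro (rfl | ⟨h1, h2⟩)
      · exact ⟨hs, h.lt⟩
      · exact ⟨h1, h2.trans h.lt⟩
  have e1 : ∀ J ∈ K.powerset, insert j K \ J = insert j (K \ J) := fun J hJ =>
    Finset.insert_sdiff_of_notMem _ fun hh => hj (Finset.mem_powerset.1 hJ hh)
  have e2 : ∀ J ∈ K.powerset, insert j K \ insert j J = K \ J := fun J hJ => by
    rw [Finset.insert_sdiff_insert, Finset.sdiff_insert_of_notMem hj]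
  rw [partialSum, hK', Finset.sum_powerset_insert hj, add_comm]
  congr 1
  · rw [partialSum, ← hK, Finset.mul_sum]
    refine Finset.sum_congr rfl fun J hJ => ?_
    rw [e2 J hJ, sort_insert_of_forall_lt, chain_append_singleton, mul_smul_comm]
    intro i hi
    exact (Finset.mem_filter.1 (Finset.mem_powerset.1 hJ hi)).2.2
  · rw [partialSum, ← hK, Finset.smul_sum]
    refine Finset.sum_congr rfl fun J hJ => ?_
    rw [e1 J hJ, Finset.prod_insert (fun hh => hj (Finset.mem_sdiff.1 hh).1), smul_smul]

theorem elemS_eq_partialSum (lam : Weight m n) (s : Fin m) (t : Fin n) :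
    elemS lam s t = partialSum (coeffC lam s t) (bar s) (pos t) (pos t) := by
  have : between s t = Finset.univ.filter fun k => bar s < k ∧ k < pos t := by
    ext; simp [between]
  rw [elemS, partialSum, ← this]
  refine Finset.sum_congr rfl fun J _ => ?_
  rw [coeffD, elemE]

section Module

variable {V : Type*} [AddCommGroup V] [Module (U m n) V]

/-- The vector `S_j v`, where `S_j` is the full sum over chains from `s` to `j`; it is `v` itself
for `j = s`. -/
noncomputable def partialVec (c : Idx m n → ℂ) (s : Idx m n) (v : V) (j : Idx m n) : V :=
  if j = s then v else partialSum c s j j • v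

variable {c : Idx m n → ℂ} {s : Idx m n} {v : V}

@[simp]
theorem partialVec_self : partialVec c s v s = v := if_pos rfl

theorem partialVec_of_lt {j : Idx m n} (h : s < j) :
    partialVec c s v j = partialSum c s j j • v := if_neg h.ne'

variable [Module ℂ V]

/-- A vector of weight `mu` killed by all `E_{i,j}`, `i < j`; it may vanish. -/
structure IsHighestWeight (mu : Weight m n) (v : V) : Prop where
  weight : IsWeightVec mu v
  raise : ∀ i j, i < j → (gen i j : U m n) • v = 0

variable [IsScalarTower ℂ (U m n) V] {lam : Weight m n}

/-- `E_{l,s} v` plays the role of `E_{l,j} S_j v` for `j = s`, so that base and step of the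
recursion for the partial sums take the same form. -/
theorem partialSum_smul_of_covBy {j j' : Idx m n} (l : Idx m n) (hs : s ≤ j) (h : j ⋖ j') :
    partialSum c s j' l • v = (gen l j : U m n) • partialVec c s v j +
      if j = s then 0 else c j • partialSum c s j l • v := by
  rcases hs.eq_or_lt with rfl | hs
  · simp [partialSum_base c l h]
  · rw [partialSum_step c l hs h, partialVec_of_lt hs, if_neg hs.ne', add_smul, mul_smul,
      smul_assoc]

theorem IsHighestWeight.partialSum_smul (hv : IsHighestWeight lam v) {j : Idx m n} (hj : s < j) :
    ∀ l, IsWeightVec (lam + basisWeight l - basisWeight s) (partialSum c s j l • v) := by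
  refine covBy_induction (s := s) (P := fun j => s < j → ∀ l,
    IsWeightVec (lam + basisWeight l - basisWeight s) (partialSum c s j l • v))
    (fun h => absurd h (lt_irrefl _)) ?_ hj.le hj
  intro i j hi hij ih _ l
  rw [partialSum_smul_of_covBy l hi hij]
  rcases hi.eq_or_lt with rfl | hi
  · simpa using hv.weight.gen_smul l s
  · rw [if_neg hi.ne', partialVec_of_lt hi]
    have h1 := (ih hi i).gen_smul l i
    have h2 := ih hi l
    intro k
    rw [smul_add, smul_comm_U, h1 k, h2 k, smul_add, smul_comm (c i)]
    congr 2
    simp only [Pi.add_apply, Pi.sub_apply]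
    ring

theorem IsHighestWeight.partialVec (hv : IsHighestWeight lam v) {j : Idx m n} (hj : s ≤ j) :
    IsWeightVec (lam + basisWeight j - basisWeight s) (partialVec c s v j) := by
  rcases hj.eq_or_lt with rfl | hj
  · simpa using hv.weight
  · rw [partialVec_of_lt hj]; exact hv.partialSum_smul hj j

/-- The condition on the coefficients under which each `S_j v` is killed by all simple raising
operators other than `E_{i,j}`, `i ⋖ j`. The value at `s` does not occur in the partial sums; with
this choice the condition for the first step from `s` takes the same form as for the later ones. -/
structure IsAdapted (c : Idx m n → ℂ) (s : Idx m n) (lam : Weight m n) : Prop where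
  base : c s = -1
  step : ∀ a b, s ≤ a → a ⋖ b → lam a + 1 + c a = genSgn a b b a * (lam b + c b)

/-- The action of the simple raising operators `E_{a,b}`, `a ⋖ b`, on the partial sums. In
particular `S_j v` is killed by all of them except for the one with `b = j`, which maps it to a
multiple of `S_a v`. -/
structure RaiseRules (c : Idx m n → ℂ) (s : Idx m n) (v : V) (j : Idx m n) : Prop where
  zero : ∀ l a b, j ≤ l → a ⋖ b → b ≠ l → b ≠ j →
    (gen a b : U m n) • partialSum c s j l • v = 0
  skip : ∀ l a, j < l → a ⋖ j → (gen a j : U m n) • partialSum c s j l • v =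
    -(genSgn a j l a • (gen l j : U m n) • partialVec c s v a)
  last : ∀ a, a ⋖ j → (gen a j : U m n) • partialSum c s j j • v =
    (genSgn a j j a * c j) • partialVec c s v a
  top : ∀ l a, j ≤ a → a ⋖ l → (gen a l : U m n) • partialSum c s j l • v =
    partialSum c s j a • v

theorem sgn_add_right (p q r : ZMod 2) : sgn p (q + r) = sgn p q * sgn p r := by
  have h2 : ∀ a : ZMod 2, a = 0 ∨ a = 1 := by decide
  have h11 : (1 + 1 : ZMod 2) = 0 := rfl
  rcases h2 p with rfl | rfl <;> rcases h2 q with rfl | rfl <;> rcases h2 r with rfl | rfl <;>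
    simp [sgn, h11, ZMod.val_one]

theorem genSgn_mul (a b l j k : Idx m n) :
    genSgn a b l j * genSgn a b j k = genSgn a b l k := by
  rw [genSgn, genSgn, genSgn, ← sgn_add_right]
  congr 1
  have : par j + par j = 0 := CharTwo.add_self_eq_zero _
  linear_combination this

theorem raiseRules (hv : IsHighestWeight lam v) (hc : IsAdapted c s lam) {j : Idx m n}
    (hj : s < j) : RaiseRules c s v j := by
  refine covBy_induction (s := s) (P := fun j => s < j → RaiseRules c s v j)
    (fun h => absurd h (lt_irrefl _)) ?_ hj.le hj
  intro i j hi hij ih _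
  -- `S_i v` is killed by `E_{a,b}` unless `b = i`
  have hz : ∀ a b, a ⋖ b → b ≠ i → (gen a b : U m n) • partialVec c s v i = 0 := by
    intro a b hab hb
    rcases hi.eq_or_lt with rfl | hi
    · rw [partialVec_self, hv.raise a b hab.lt]
    · rw [partialVec_of_lt hi]
      exact (ih hi).zero i a b le_rfl hab hb hb
  constructor
  · intro l a b hl hab hbl hbj
    have hai : a ≠ i := fun h => hbj (by subst h; exact hab.unique_right hij)
    rw [partialSum_smul_of_covBy l hi hij, smul_add, gen_smul_gen_smul, if_neg hbl, if_neg hai]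
    rcases hi.eq_or_lt with rfl | hi
    · simp [hv.raise a b hab.lt]
    rw [if_neg hi.ne', smul_comm_U]
    rcases eq_or_ne b i with rfl | hbi
    · rw [(ih hi).skip l a (hij.lt.trans_le hl) hab, partialVec_of_lt hi, (ih hi).last a hab,
        smul_comm_U, smul_neg, smul_smul, smul_smul, ← mul_assoc, genSgn_mul, mul_comm (c b)]
      simp
    · rw [hz a b hab hbi, (ih hi).zero l a b (hij.le.trans hl) hab hbl hbi]
      simp
  · intro l a hl haj
    obtain rfl : a = i := haj.unique_left hij
    rw [partialSum_smul_of_covBy l hi hij, smul_add, gen_smul_gen_smul, if_neg hl.ne, if_pos rfl,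
      hz a j hij hij.lt.ne']
    rcases hi.eq_or_lt with rfl | hi
    · simp
    · rw [if_neg hi.ne', smul_comm_U, (ih hi).zero l a j (hij.lt.trans hl).le hij hl.ne
        hij.lt.ne']
      simp
  · intro a haj
    obtain rfl : a = i := haj.unique_left hij
    have hw := hv.partialVec (c := c) hi
    rw [partialSum_smul_of_covBy j hi hij, smul_add, gen_smul_gen_smul, if_pos rfl, if_pos rfl,
      hz a j hij hij.lt.ne', hw a, hw j]
    have hst := hc.step a j hi hij
    simp only [Pi.add_apply, Pi.sub_apply, basisWeight, Pi.single_apply,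
      if_neg hij.lt.ne', if_true]
    rcases hi.eq_or_lt with rfl | hi
    · rw [if_pos rfl, if_pos rfl, smul_zero, smul_zero, smul_zero, zero_add, add_zero,
        smul_smul, ← sub_smul, if_neg hij.lt.ne']
      congr 1
      rw [hc.base] at hst
      linear_combination hst
    · rw [if_neg hi.ne', if_neg hi.ne', smul_comm_U, (ih hi).top j a le_rfl hij,
        partialVec_of_lt hi, smul_zero, smul_zero, zero_add, smul_smul, ← sub_smul, ← add_smul,
        if_neg (hi.trans hij.lt).ne']
      congr 1
      linear_combination hst
  · intro l a hja hal
    rw [partialSum_smul_of_covBy l hi hij, partialSum_smul_of_covBy a hi hij, smul_add,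
      gen_smul_gen_smul, if_pos rfl, if_neg (hij.lt.trans_le hja).ne',
      hz a l hal (hij.lt.trans_le (hja.trans hal.le)).ne']
    rcases hi.eq_or_lt with rfl | hi
    · simp
    · rw [if_neg hi.ne', if_neg hi.ne', smul_comm_U, (ih hi).top l a (hij.le.trans hja) hal]
      simp

/-- The simple raising operators generate `𝔫⁺`. -/
theorem raise_of_covBy {x : V} (h : ∀ a b, a ⋖ b → (gen a b : U m n) • x = 0) (a b : Idx m n)
    (hab : a < b) : (gen a b : U m n) • x = 0 := by
  refine covBy_induction (s := a) (P := fun b => a < b → (gen a b : U m n) • x = 0)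
    (fun h => absurd h (lt_irrefl _)) ?_ hab.le hab
  intro i j hi hij ih _
  rcases hi.eq_or_lt with rfl | hi
  · exact h _ _ hij
  · have := gen_smul_gen_smul a i i j x
    rw [h i j hij, ih hi, if_pos rfl, if_neg (hi.trans hij.lt).ne] at this
    simpa using this.symm

/-- If the last coefficient vanishes, then the full sum is killed by `𝔫⁺`. -/
theorem raise_partialSum (hv : IsHighestWeight lam v) (hc : IsAdapted c s lam) {t : Idx m n}
    (hst : s < t) (ht : c t = 0) (a b : Idx m n) (hab : a < b) :
    (gen a b : U m n) • partialSum c s t t • v = 0 := by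
  refine raise_of_covBy (fun a b hab => ?_) a b hab
  have h := raiseRules hv hc hst
  rcases eq_or_ne b t with rfl | hb
  · rw [h.last a hab, ht, mul_zero, zero_smul]
  · exact h.zero t a b le_rfl hab hb hb

end Module

/-! ### The coefficients `c_k` and the atypicality condition -/

theorem bar_or_pos (k : Idx m n) : (∃ i, k = bar i) ∨ ∃ j, k = pos j := by
  rcases h : ofLex k with i | j
  · exact Or.inl ⟨OrderDual.ofDual i, congrArg toLex h⟩
  · exact Or.inr ⟨j, congrArg toLex h⟩

theorem bar_lt_bar {i j : Fin m} : (bar i : Idx m n) < bar j ↔ j < i := by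
  simp [bar]

theorem pos_lt_pos {i j : Fin n} : (pos i : Idx m n) < pos j ↔ i < j := by
  simp [pos]

theorem bar_lt_pos (i : Fin m) (j : Fin n) : (bar i : Idx m n) < pos j := by
  simp [pos, bar]

theorem not_pos_lt_bar (i : Fin m) (j : Fin n) : ¬ (pos j : Idx m n) < bar i :=
  (bar_lt_pos i j).asymm

theorem bar_ne_pos (i : Fin m) (j : Fin n) : (bar i : Idx m n) ≠ pos j :=
  (bar_lt_pos i j).ne

theorem bar_injective : Function.Injective (bar : Fin m → Idx m n) := fun i j h => by
  simpa [bar] using h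

theorem pos_injective : Function.Injective (pos : Fin n → Idx m n) := fun i j h => by
  simpa [pos] using h

theorem par_bar (i : Fin m) : par (bar i : Idx m n) = 0 := rfl

theorem par_pos (j : Fin n) : par (pos j : Idx m n) = 1 := rfl

theorem sum_idx {A : Type*} [AddCommMonoid A] (f : Idx m n → A) :
    ∑ k, f k = ∑ i : Fin m, f (bar i) + ∑ j : Fin n, f (pos j) := by
  rw [← (toLex (α := (Fin m)ᵒᵈ ⊕ Fin n)).sum_comp, Fintype.sum_sum_type,
    ← (OrderDual.toDual (α := Fin m)).sum_comp]
  rfl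

theorem rho_apply (k : Idx m n) :
    rho m n k = 1 / 2 * ∑ l, (if par k = par l then 1 else -1) *
      ((if k < l then 1 else 0) - if l < k then 1 else 0) := by
  have h : ∀ r : Idx m n × Idx m n, (basisWeight r.1 - basisWeight r.2 : Weight m n) k =
      (if k = r.1 then 1 else 0) - if k = r.2 then 1 else 0 := fun r => by
    simp [basisWeight, Pi.single_apply]
  rw [rho, Pi.smul_apply, smul_eq_mul, Pi.sub_apply, Finset.sum_apply, Finset.sum_apply]
  congr 1
  simp only [h, Finset.sum_filter]
  rw [← Finset.sum_sub_distrib, Fintype.sum_prod_type]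
  have h1 : ∀ i j : Idx m n,
      ((if i < j ∧ par i = par j then ((if k = i then 1 else 0) - if k = j then 1 else 0 : ℂ)
        else 0) - if i < j ∧ par i ≠ par j then ((if k = i then 1 else 0) - if k = j then 1 else 0)
          else 0) =
      (if k = i then (if par k = par j then 1 else -1) * (if k < j then 1 else 0) else 0) -
      if k = j then (if par k = par i then 1 else -1) * (if i < k then 1 else 0) else 0 := by
    intro i j
    rcases eq_or_ne k i with rfl | hi <;> rcases eq_or_ne k j with rfl | hj
    · simp
    · by_cases hij : k < j <;> by_cases hp : par k = par j <;> simp [hij, hp, hj]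
    · by_cases hij : i < k <;> by_cases hp : par i = par k <;>
        simp [hij, hi, eq_comm (a := par k), hp]
    · simp [hi, hj]
  simp only [h1, Finset.sum_sub_distrib, Finset.sum_ite_eq, Finset.mem_univ, if_true, mul_sub]
  congr 1
  rw [Finset.sum_comm]
  simp

theorem sum_ite_lt (N : ℕ) (i : Fin N) : ∑ j : Fin N, (if j < i then 1 else 0 : ℂ) = i := by
  rw [Finset.sum_boole]
  congr 1
  rw [← Fin.card_Iio i]
  congr 1
  ext; simp

theorem sum_ite_gt (N : ℕ) (i : Fin N) :
    ∑ j : Fin N, (if i < j then 1 else 0 : ℂ) = N - 1 - i := by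
  rw [Finset.sum_boole]
  have h : (Finset.univ.filter fun j => i < j).card = N - 1 - i := by
    rw [← Fin.card_Ioi i]; congr 1; ext; simp
  rw [h, Nat.cast_sub (by omega), Nat.cast_sub (by omega), Nat.cast_one]

theorem rho_bar (i : Fin m) : rho m n (bar i) = (i : ℂ) + (1 - m - n) / 2 := by
  rw [rho_apply, sum_idx]
  simp only [par_bar, par_pos, bar_lt_bar, bar_lt_pos, not_pos_lt_bar, if_true, if_false, one_mul,
    Finset.sum_sub_distrib, sum_ite_lt, sum_ite_gt]
  simp
  ring

theorem rho_pos (j : Fin n) : rho m n (pos j) = -(j : ℂ) + (m + n - 1) / 2 := by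
  rw [rho_apply, sum_idx]
  simp only [par_bar, par_pos, pos_lt_pos, bar_lt_pos, not_pos_lt_bar, if_true, if_false, one_mul,
    Finset.sum_sub_distrib, sum_ite_lt, sum_ite_gt]
  simp
  ring

theorem isAtypical_iff (lam : Weight m n) (s : Fin m) (t : Fin n) :
    IsAtypical lam (oddRoot s t) ↔ lam (bar s) + lam (pos t) + s - t = 0 := by
  have h1 : ∀ i : Fin m, oddRoot s t (bar i) = if i = s then 1 else 0 := fun i => by
    simp [oddRoot, basisWeight, Pi.single_apply, bar_ne_pos, bar_injective.eq_iff]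
  have h2 : ∀ j : Fin n, oddRoot s t (pos j) = -if j = t then 1 else 0 := fun i => by
    simp [oddRoot, basisWeight, Pi.single_apply, (bar_ne_pos _ _).symm, pos_injective.eq_iff]
  rw [IsAtypical, form]
  simp only [h1, h2, mul_neg, mul_ite, mul_one, mul_zero, Finset.sum_neg_distrib,
    Finset.sum_ite_eq', Finset.mem_univ, if_true, Pi.add_apply, rho_bar, rho_pos]
  ring_nf

theorem coeffC_bar (lam : Weight m n) (s : Fin m) (t : Fin n) (i : Fin m) :
    coeffC lam s t (bar i) = lam (bar s) - lam (bar i) + ((s : ℂ) - i - 1) := rfl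

theorem coeffC_pos (lam : Weight m n) (s : Fin m) (t : Fin n) (j : Fin n) :
    coeffC lam s t (pos j) = lam (pos t) - lam (pos j) - ((t : ℂ) - j) := rfl

theorem coeffC_pos_self (lam : Weight m n) (s : Fin m) (t : Fin n) :
    coeffC lam s t (pos t) = 0 := by
  rw [coeffC_pos]; ring

theorem bar_covBy_bar {i j : Fin m} (h : (bar i : Idx m n) ⋖ bar j) : (i : ℕ) = j + 1 := by
  have h1 : j < i := bar_lt_bar.1 h.lt
  by_contra hne
  have h2 : (j : ℕ) + 1 < i := lt_of_le_of_ne h1 (Ne.symm hne)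
  exact h.2 (c := bar ⟨j + 1, h2.trans i.2⟩) (bar_lt_bar.2 h2) (bar_lt_bar.2 (Nat.lt_succ_self _))

theorem pos_covBy_pos {i j : Fin n} (h : (pos i : Idx m n) ⋖ pos j) : (j : ℕ) = i + 1 := by
  have h1 : i < j := pos_lt_pos.1 h.lt
  by_contra hne
  have h2 : (i : ℕ) + 1 < j := lt_of_le_of_ne h1 (Ne.symm hne)
  exact h.2 (c := pos ⟨i + 1, h2.trans j.2⟩) (pos_lt_pos.2 (Nat.lt_succ_self _)) (pos_lt_pos.2 h2)

theorem bar_covBy_pos {i : Fin m} {j : Fin n} (h : (bar i : Idx m n) ⋖ pos j) :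
    (i : ℕ) = 0 ∧ (j : ℕ) = 0 := by
  constructor
  · by_contra hne
    exact h.2 (c := bar ⟨0, i.pos⟩) (bar_lt_bar.2 (Nat.pos_of_ne_zero hne)) (bar_lt_pos _ _)
  · by_contra hne
    exact h.2 (c := pos ⟨0, j.pos⟩) (bar_lt_pos _ _) (pos_lt_pos.2 (Nat.pos_of_ne_zero hne))

/-- Up to the sign at the step from `1̄` to `1`, the sums `λ_k + c_k` increase by one with `k`; at
the sign change this is the atypicality of `λ`. -/
theorem isAdapted_coeffC {lam : Weight m n} {s : Fin m} {t : Fin n}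
    (h : IsAtypical lam (oddRoot s t)) : IsAdapted (coeffC lam s t) (bar s) lam := by
  rw [isAtypical_iff] at h
  have h11 : (1 + 1 : ZMod 2) = 0 := rfl
  constructor
  · rw [coeffC_bar]; ring
  · intro a b _ hab
    rcases bar_or_pos a with ⟨i, rfl⟩ | ⟨i, rfl⟩ <;> rcases bar_or_pos b with ⟨j, rfl⟩ | ⟨j, rfl⟩
    · have hi : (i : ℂ) = j + 1 := by exact_mod_cast bar_covBy_bar hab
      simp only [coeffC_bar, genSgn, par_bar, sgn, hi]
      simp
      ring
    · obtain ⟨hi, hj⟩ := bar_covBy_pos hab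
      simp only [coeffC_bar, coeffC_pos, genSgn, par_bar, par_pos, sgn, hi, hj]
      simp [ZMod.val_one]
      linear_combination h
    · exact absurd hab.lt (not_pos_lt_bar _ _)
    · have hj : (j : ℂ) = i + 1 := by exact_mod_cast pos_covBy_pos hab
      simp only [coeffC_pos, genSgn, par_pos, sgn, hj, h11]
      simp
      ring

/-! ### Oscillators with Jordan–Wigner signs -/

section Oscillator

variable {M : Type*} [Fintype M] [LinearOrder M]

/-- The Jordan–Wigner sign of the mode `A` in the state `f`: for odd `A`, the parity of the total
occupation of the odd modes below `A`. -/
noncomputable def jwSign (q : M → ZMod 2) (A : M) (f : M → ℤ) : ℂ :=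
  if q A = 0 then 1 else ∏ B with B < A ∧ q B ≠ 0, (-1 : ℂ) ^ f B

theorem jwSign_mul_self (q : M → ZMod 2) (A : M) (f : M → ℤ) :
    jwSign q A f * jwSign q A f = 1 := by
  unfold jwSign
  split_ifs
  · simp
  · rw [← Finset.prod_mul_distrib]
    refine Finset.prod_eq_one fun B _ => ?_
    rw [← mul_zpow]; simp

theorem jwSign_sub_single (q : M → ZMod 2) (A B : M) (f : M → ℤ) {d : ℤ} (hd : d = 1 ∨ d = -1) :
    jwSign q A (f - Pi.single B d) =
      (if B < A ∧ q A ≠ 0 ∧ q B ≠ 0 then -1 else 1) * jwSign q A f := by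
  unfold jwSign
  by_cases hA : q A = 0
  · simp [hA]
  have hB : ∀ C, (-1 : ℂ) ^ (f - Pi.single B d : M → ℤ) C =
      (if C = B then -1 else 1) * (-1 : ℂ) ^ f C := fun C => by
    rw [Pi.sub_apply, zpow_sub₀ (by simp), Pi.single_apply]
    split_ifs
    · rcases hd with rfl | rfl <;> simp [zpow_neg, div_neg]
    · simp
  rw [if_neg hA, if_neg hA]
  simp only [hB, Finset.prod_mul_distrib]
  congr 1
  rw [Finset.prod_ite_eq']
  simp [hA]

/-- The operator on functions of the occupation numbers that shifts the occupation of `A` by `d`,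
with coefficient `g` and the Jordan–Wigner sign. -/
noncomputable def shiftOp (q : M → ZMod 2) (A : M) (d : ℤ) (g : ℤ → ℂ) :
    Module.End ℂ ((M → ℤ) → ℂ) where
  toFun ψ f := jwSign q A f * g (f A) * ψ (f - Pi.single A d)
  map_add' ψ χ := by ext f; simp [mul_add]
  map_smul' c ψ := by ext f; simp; ring

theorem shiftOp_apply (q : M → ZMod 2) (A : M) (d : ℤ) (g : ℤ → ℂ) (ψ : (M → ℤ) → ℂ) (f : M → ℤ) :
    shiftOp q A d g ψ f = jwSign q A f * g (f A) * ψ (f - Pi.single A d) := rfl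

theorem shiftOp_mul_of_ne (q : M → ZMod 2) {A B : M} (hAB : A ≠ B) {d d' : ℤ} (g g' : ℤ → ℂ)
    (hd : d = 1 ∨ d = -1) (hd' : d' = 1 ∨ d' = -1) :
    shiftOp q A d g * shiftOp q B d' g' =
      sgn (q A) (q B) • (shiftOp q B d' g' * shiftOp q A d g) := by
  ext ψ f
  simp only [Module.End.mul_apply, LinearMap.smul_apply, Pi.smul_apply, shiftOp_apply, smul_eq_mul,
    jwSign_sub_single q _ _ _ hd, jwSign_sub_single q _ _ _ hd', Pi.sub_apply,
    Pi.single_eq_of_ne hAB, Pi.single_eq_of_ne hAB.symm, sub_zero,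
    sub_right_comm f (Pi.single A d) (Pi.single B d')]
  have hs : sgn (q A) (q B) = if q A ≠ 0 ∧ q B ≠ 0 then -1 else 1 := by
    have h2 : ∀ a : ZMod 2, a = 0 ∨ a = 1 := by decide
    rcases h2 (q A) with h | h <;> rcases h2 (q B) with h' | h' <;>
      simp [h, h', sgn, ZMod.val_one]
  rw [hs]
  by_cases h1 : q A = 0 <;> by_cases h2 : q B = 0
  · simp [h1, h2]; ring
  · simp [h1, h2]; ring
  · simp [h1, h2]; ring
  · rcases hAB.lt_or_gt with h | h
    · simp [h1, h2, h, h.asymm]; ring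
    · simp [h1, h2, h, h.asymm]; ring

theorem shiftOp_mul_self (q : M → ZMod 2) (A : M) {d d' : ℤ} (g g' : ℤ → ℂ)
    (hd : d = 1 ∨ d = -1) (ψ : (M → ℤ) → ℂ) (f : M → ℤ) :
    (shiftOp q A d g * shiftOp q A d' g') ψ f =
      g (f A) * g' (f A - d) * ψ (f - Pi.single A (d + d')) := by
  simp only [Module.End.mul_apply, shiftOp_apply, jwSign_sub_single q _ _ _ hd, Pi.sub_apply,
    Pi.single_eq_same, sub_sub, Pi.single_add]
  simp only [lt_irrefl, false_and, if_false, one_mul]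
  linear_combination (g (f A) * g' (f A - d) * ψ (f - (Pi.single A d + Pi.single A d'))) *
    jwSign_mul_self q A f

end Oscillator

/-! ### Oscillator realization of the relations -/

/-- Operators with the supercommutation relations of creation operators `Y k i` and annihilation
operators `Z k i` of parity `|k| + |i|`. -/
structure IsOscillator {R : Type*} [Ring R] [Algebra ℂ R] (Y Z : Idx m n → Idx m n → R) :
    Prop where
  yy : ∀ k i l j, Y k i * Y l j = sgn (par k + par i) (par l + par j) • (Y l j * Y k i)
  zz : ∀ k i l j, Z k i * Z l j = sgn (par k + par i) (par l + par j) • (Z l j * Z k i)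
  zy : ∀ k i l j, Z k i * Y l j = sgn (par k + par i) (par l + par j) • (Y l j * Z k i) +
    if k = l ∧ i = j then 1 else 0

theorem sgn_comm (p q : ZMod 2) : sgn p q = sgn q p := by rw [sgn, sgn, mul_comm]

theorem sgn_add_left (p q r : ZMod 2) : sgn (p + q) r = sgn p r * sgn q r := by
  rw [sgn_comm, sgn_add_right, sgn_comm r, sgn_comm r]

/-- The operators `∑ᵢ Y_{k,i} Z_{l,i}` satisfy the relations of the matrix units. -/
theorem IsOscillator.relation {R : Type*} [Ring R] [Algebra ℂ R] {Y Z : Idx m n → Idx m n → R}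
    (h : IsOscillator Y Z) (a b c d : Idx m n) :
    (∑ i, Y a i * Z b i) * (∑ i, Y c i * Z d i) =
      genSgn a b c d • ((∑ i, Y c i * Z d i) * (∑ i, Y a i * Z b i)) +
      ((if b = c then ∑ i, Y a i * Z d i else 0) -
        genSgn a b c d • (if a = d then ∑ i, Y c i * Z b i else 0)) := by
  have key : ∀ i j, (Y a i * Z b i) * (Y c j * Z d j) =
      genSgn a b c d • ((Y c j * Z d j) * (Y a i * Z b i)) +
      ((if i = j then (if b = c then Y a i * Z d i else 0) else 0) -
        (if i = j then genSgn a b c d • (if a = d then Y c i * Z b i else 0) else 0)) := by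
    intro i j
    have hs : genSgn a b c d * sgn (par d + par j) (par a + par i) =
        sgn (par b + par i) (par c + par j) * sgn (par a + par i) (par c + par j) *
          sgn (par b + par i) (par d + par j) := by
      have h1 : genSgn a b c d =
          sgn ((par a + par i) + (par b + par i)) ((par c + par j) + (par d + par j)) := by
        have hi : par i + par i = 0 := CharTwo.add_self_eq_zero _
        have hj : par j + par j = 0 := CharTwo.add_self_eq_zero _
        rw [genSgn]
        congr 1
        · linear_combination -hi
        · linear_combination -hj
      rw [h1]
      generalize par a + par i = A
      generalize par b + par i = B
      generalize par c + par j = C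
      generalize par d + par j = D
      rw [sgn_add_left, sgn_add_right A, sgn_add_right B, sgn_comm D A]
      linear_combination (sgn A C * sgn B C * sgn B D) * sgn_mul_self A D
    have e1 : (Y a i * Z b i) * (Y c j * Z d j) = Y a i * (Z b i * Y c j) * Z d j := by
      simp only [mul_assoc]
    have e2 : (Y c j * Z d j) * (Y a i * Z b i) = Y c j * (Z d j * Y a i) * Z b i := by
      simp only [mul_assoc]
    have e3 : Y a i * (Y c j * Z b i) * Z d j =
        (sgn (par a + par i) (par c + par j) * sgn (par b + par i) (par d + par j)) •
          (Y c j * (Y a i * Z d j) * Z b i) := by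
      calc Y a i * (Y c j * Z b i) * Z d j = (Y a i * Y c j) * (Z b i * Z d j) := by
            simp only [mul_assoc]
        _ = _ := by
            rw [h.yy, h.zz]
            simp only [smul_mul_assoc, mul_smul_comm, smul_smul, mul_assoc]
            rw [mul_comm (sgn _ _)]
    rw [e1, e2, h.zy, h.zy]
    simp only [mul_add, add_mul, smul_mul_assoc, mul_smul_comm, smul_add, smul_smul, e3, hs]
    rw [← mul_assoc, add_assoc]
    congr 1
    by_cases hij : i = j
    · subst hij
      by_cases hbc : b = c <;> by_cases had : a = d <;> simp [hbc, had, eq_comm (a := d)]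
    · simp [hij, Ne.symm hij]
  simp only [Finset.sum_mul_sum, key, Finset.sum_add_distrib, Finset.sum_sub_distrib,
    Finset.sum_ite_eq, Finset.mem_univ, if_true]
  congr 1
  · rw [Finset.sum_comm]; simp only [Finset.smul_sum]
  · split_ifs <;> simp [Finset.smul_sum]

/-! ### The Fock module -/

/-- Modes are pairs of indices; the linear order serves only to define the Jordan–Wigner signs. -/
abbrev Mode (m n : ℕ) : Type := Idx m n ×ₗ Idx m n

/-- The mode `(k, i)`. -/
def mode (k i : Idx m n) : Mode m n := toLex (k, i)

theorem mode_inj {k i l j : Idx m n} : mode k i = mode l j ↔ k = l ∧ i = j := by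
  simp [mode]

/-- The parity `|k| + |i|` of the mode `(k, i)`. -/
def modePar (A : Mode m n) : ZMod 2 := par (ofLex A).1 + par (ofLex A).2

/-- Functions of the occupation numbers of the modes. -/
abbrev Fock (m n : ℕ) : Type := (Mode m n → ℤ) → ℂ

/-- The coefficient of the creation operator of the mode `(k, i)`, as a function of the occupation
number of the resulting state. For `k < i` the vacuum is killed
by the creation operator, otherwise by the annihilation operator; the diagonal modes are bosons
with occupation numbers in a coset of `ℤ`. -/
noncomputable def createCoeff (k i : Idx m n) (x : ℤ) : ℂ :=
  if k < i then (if par k = par i then x - 1 else if Even x then 1 else 0)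
  else if par k = par i then 1 else if Even x then 0 else 1

/-- The coefficient of the annihilation operator of the mode `(k, i)`, as a function of the
occupation number of the resulting state; the parameter `a` shifts the occupation numbers of the
diagonal modes. -/
noncomputable def annihilateCoeff (a : Idx m n → ℂ) (k i : Idx m n) (x : ℤ) : ℂ :=
  if k < i then (if par k = par i then 1 else if Even x then 0 else 1)
  else if par k = par i then x + 1 + (if k = i then a k else 0) else if Even x then 1 else 0

/-- The creation operator `Y_{k,i}`; for `k < i` it is the one that kills the vacuum. -/
noncomputable def create (k i : Idx m n) : Module.End ℂ (Fock m n) :=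
  shiftOp modePar (mode k i) 1 (createCoeff k i)

/-- The annihilation operator `Z_{k,i}`, which lowers the occupation number. -/
noncomputable def annihilate (a : Idx m n → ℂ) (k i : Idx m n) : Module.End ℂ (Fock m n) :=
  shiftOp modePar (mode k i) (-1) (annihilateCoeff a k i)

theorem sgn_par_add (k i : Idx m n) :
    sgn (par k + par i) (par k + par i) = if par k = par i then 1 else -1 := by
  have h2 : ∀ a : ZMod 2, a = 0 ∨ a = 1 := by decide
  have h11 : (1 + 1 : ZMod 2) = 0 := rfl
  rcases h2 (par k) with h | h <;> rcases h2 (par i) with h' | h' <;>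
    simp [h, h', sgn, ZMod.val_one, h11]

theorem isOscillator (a : Idx m n → ℂ) :
    IsOscillator (create (m := m) (n := n)) (annihilate a) := by
  constructor
  · intro k i l j
    by_cases h : k = l ∧ i = j
    · obtain ⟨rfl, rfl⟩ := h
      rw [sgn_par_add]
      split_ifs with hp
      · rw [one_smul]
      · -- the square of an odd operator vanishes
        have : create k i * create k i = 0 := by
          ext ψ f
          rw [create, shiftOp_mul_self _ _ _ _ (Or.inl rfl)]
          simp only [createCoeff, hp, if_false, Int.even_sub_one]
          split_ifs <;> simp
        simp [this]
    · exact shiftOp_mul_of_ne _ (mode_inj.not.2 h) _ _ (Or.inl rfl) (Or.inl rfl)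
  · intro k i l j
    by_cases h : k = l ∧ i = j
    · obtain ⟨rfl, rfl⟩ := h
      rw [sgn_par_add]
      split_ifs with hp
      · rw [one_smul]
      · have : annihilate a k i * annihilate a k i = 0 := by
          ext ψ f
          rw [annihilate, shiftOp_mul_self _ _ _ _ (Or.inr rfl)]
          simp only [annihilateCoeff, hp, if_false, sub_neg_eq_add, Int.even_add_one]
          split_ifs <;> simp
        simp [this]
    · exact shiftOp_mul_of_ne _ (mode_inj.not.2 h) _ _ (Or.inr rfl) (Or.inr rfl)
  · intro k i l j
    by_cases h : k = l ∧ i = j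
    · obtain ⟨rfl, rfl⟩ := h
      rw [sgn_par_add, if_pos (⟨rfl, rfl⟩ : k = k ∧ i = i)]
      ext ψ f
      rw [LinearMap.add_apply, Pi.add_apply, LinearMap.smul_apply, Pi.smul_apply, create,
        annihilate, shiftOp_mul_self _ _ _ _ (Or.inl rfl),
        shiftOp_mul_self _ _ _ _ (Or.inr rfl)]
      simp only [createCoeff, annihilateCoeff, Module.End.one_apply, add_neg_cancel,
        neg_add_cancel, Pi.single_zero, sub_zero, smul_eq_mul, sub_neg_eq_add, Int.even_add_one,
        Int.even_sub_one]
      by_cases h1 : k < i <;> by_cases h2 : par k = par i <;>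
        by_cases h3 : Even (f (mode k i)) <;> simp [h1, h2, h3] <;> ring
    · rw [if_neg h, add_zero]
      exact shiftOp_mul_of_ne _ (mode_inj.not.2 h) _ _ (Or.inr rfl) (Or.inl rfl)

/-- The action of `E_{k,l}` on the Fock module. -/
noncomputable def fockGen (a : Idx m n → ℂ) (k l : Idx m n) : Module.End ℂ (Fock m n) :=
  ∑ i, create k i * annihilate a l i

theorem mem_span_unit_of_mem_homog {p : ZMod 2} {x : Gl m n} (hx : x ∈ homog m n p) :
    x ∈ Submodule.span ℂ {y | ∃ i j, par i + par j = p ∧ y = unit i j} := by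
  rw [gl_eq_sum x]
  refine Submodule.sum_mem _ fun i _ => Submodule.sum_mem _ fun j _ => ?_
  by_cases h : par i + par j = p
  · exact Submodule.smul_mem _ _ (Submodule.subset_span ⟨i, j, h, rfl⟩)
  · rw [hx i j h, zero_smul]; exact Submodule.zero_mem _

/-- The linear extension of `fockGen` to `gl(m|n)`. -/
noncomputable def fockLin (a : Idx m n → ℂ) : Gl m n →ₗ[ℂ] Module.End ℂ (Fock m n) where
  toFun x := ∑ k, ∑ l, x k l • fockGen a k l
  map_add' x y := by simp [add_smul, Finset.sum_add_distrib]
  map_smul' c x := by simp [Finset.smul_sum, smul_smul]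

theorem fockLin_unit (a : Idx m n → ℂ) (k l : Idx m n) : fockLin a (unit k l) = fockGen a k l := by
  change ∑ i, ∑ j, unit k l i j • fockGen a i j = _
  rw [Finset.sum_eq_single k, Finset.sum_eq_single l]
  · simp [unit]
  · intro j _ hj; simp [unit, Ne.symm hj]
  · simp
  · intro i _ hi; simp [unit, Ne.symm hi]
  · simp

theorem fockLin_bracket (a : Idx m n → ℂ) {p q : ZMod 2} {x y : Gl m n} (hx : x ∈ homog m n p)
    (hy : y ∈ homog m n q) :
    fockLin a x * fockLin a y - sgn p q • (fockLin a y * fockLin a x) =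
      fockLin a (superBracket p q x y) := by
  have hx' := mem_span_unit_of_mem_homog hx
  have hy' := mem_span_unit_of_mem_homog hy
  clear hx hy
  unfold superBracket
  induction hx', hy' using Submodule.span_induction₂ with
  | mem_mem x y hx hy =>
    obtain ⟨i, j, rfl, rfl⟩ := hx
    obtain ⟨k, l, rfl, rfl⟩ := hy
    simp only [fockLin_unit, map_sub, map_smul]
    have h := (isOscillator a).relation i j k l
    change fockGen a i j * fockGen a k l - _ = _
    change fockGen a i j * fockGen a k l = _ at h
    rw [h]
    change _ + _ - genSgn i j k l • _ = _ - genSgn i j k l • _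
    rw [show fockGen a k l * fockGen a i j = _ from rfl, fockGen, fockGen, add_sub_cancel_left]
    congr 2
    · split_ifs with h
      · subst h; rw [← fockGen, ← fockLin_unit]; simp [unit]
      · simp [unit, h]
    · split_ifs with h
      · subst h; rw [← fockGen, ← fockLin_unit]; simp [unit]
      · simp [unit, Ne.symm h]
  | zero_left y hy => simp
  | zero_right x hx => simp
  | add_left x y z _ _ _ h1 h2 =>
    simp only [map_add, add_mul, mul_add, smul_add, map_sub, map_smul] at h1 h2 ⊢
    rw [add_sub_add_comm, h1, h2]; abel
  | add_right x y z _ _ _ h1 h2 =>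
    simp only [map_add, add_mul, mul_add, smul_add, map_sub, map_smul] at h1 h2 ⊢
    rw [add_sub_add_comm, h1, h2]; abel
  | smul_left r x y _ _ h =>
    simp only [map_smul, smul_mul_assoc, mul_smul_comm, map_sub, smul_comm _ r] at h ⊢
    linear_combination (norm := module) r • h
  | smul_right r x y _ _ h =>
    simp only [map_smul, smul_mul_assoc, mul_smul_comm, map_sub, smul_comm _ r] at h ⊢
    linear_combination (norm := module) r • h

/-- The representation of `U(gl(m|n))` on the Fock module. -/
noncomputable def fockRep (a : Idx m n → ℂ) : U m n →ₐ[ℂ] Module.End ℂ (Fock m n) :=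
  RingQuot.liftAlgHom ℂ ⟨TensorAlgebra.lift ℂ (fockLin a), by
    rintro _ _ ⟨p, q, x, y, hx, hy⟩
    simpa using fockLin_bracket a hx hy⟩

theorem fockRep_ι (a : Idx m n → ℂ) (x : Gl m n) : fockRep a (ι x) = fockLin a x := by
  simp [fockRep, ι]

theorem fockRep_gen (a : Idx m n → ℂ) (k l : Idx m n) : fockRep a (gen k l) = fockGen a k l := by
  rw [gen, fockRep_ι, fockLin_unit]

theorem fockGen_apply (a : Idx m n → ℂ) (k l : Idx m n) (ψ : Fock m n) (f : Mode m n → ℤ) :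
    fockGen a k l ψ f = ∑ i, jwSign modePar (mode k i) f * createCoeff k i (f (mode k i)) *
      (jwSign modePar (mode l i) (f - Pi.single (mode k i) 1) *
        annihilateCoeff a l i ((f - Pi.single (mode k i) 1 : Mode m n → ℤ) (mode l i)) *
        ψ (f - Pi.single (mode k i) 1 - Pi.single (mode l i) (-1))) := by
  rw [fockGen, LinearMap.sum_apply, Finset.sum_apply]
  rfl

theorem single_mode_apply (k i l j : Idx m n) (d : ℤ) :
    (Pi.single (mode k i) d : Mode m n → ℤ) (mode l j) = if l = k ∧ j = i then d else 0 := by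
  rw [Pi.single_apply]
  simp only [mode_inj]

theorem createCoeff_one {k i : Idx m n} (h : k < i) : createCoeff k i 1 = 0 := by
  simp [createCoeff, h]

theorem createCoeff_self (k : Idx m n) (x : ℤ) : createCoeff k k x = 1 := by
  simp [createCoeff]

theorem annihilateCoeff_neg_one_of_lt (a : Idx m n → ℂ) {k i : Idx m n} (h : k < i) :
    annihilateCoeff a k i (-1) = 1 := by
  simp [annihilateCoeff, h]

theorem annihilateCoeff_neg_one_of_gt (a : Idx m n → ℂ) {k i : Idx m n} (h : i < k) :
    annihilateCoeff a k i (-1) = 0 := by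
  simp [annihilateCoeff, h.asymm, h.ne']

/-- The vacuum: all occupation numbers are zero. -/
noncomputable def vacuum : Fock m n := Pi.single 0 1

theorem vacuum_apply (f : Mode m n → ℤ) : (vacuum : Fock m n) f = if f = 0 then 1 else 0 := by
  rw [vacuum, Pi.single_apply]

theorem fockGen_vacuum_of_lt (a : Idx m n → ℂ) {k l : Idx m n} (h : k < l) :
    fockGen a k l vacuum = 0 := by
  ext f
  rw [fockGen_apply]
  refine Finset.sum_eq_zero fun i _ => ?_
  rw [vacuum_apply]
  split_ifs with hf
  · have h1 := congrFun hf (mode k i)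
    have h2 := congrFun hf (mode l i)
    rw [Pi.sub_apply, single_mode_apply] at h1 h2
    rw [Pi.sub_apply, single_mode_apply, if_pos ⟨rfl, rfl⟩, if_neg fun h' => h.ne h'.1] at h1
    rw [if_pos ⟨rfl, rfl⟩] at h2
    have h1' : f (mode k i) = 1 := by simp only [Pi.zero_apply] at h1; omega
    have h2' : (f - Pi.single (mode k i) 1 : Mode m n → ℤ) (mode l i) = -1 := by
      simp only [Pi.zero_apply] at h2; omega
    rcases lt_or_ge k i with hk | hk
    · rw [h1', createCoeff_one hk]; simp
    · rw [h2', annihilateCoeff_neg_one_of_gt a (hk.trans_lt h)]; simp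
  · simp

theorem fockGen_vacuum_self (a : Idx m n → ℂ) (k : Idx m n) :
    fockGen a k k vacuum =
      (a k + ∑ i with k < i, if par k = par i then -1 else 1 : ℂ) • (vacuum : Fock m n) := by
  ext f
  rw [fockGen_apply, Pi.smul_apply, vacuum_apply, smul_eq_mul]
  have hf : ∀ i, f - Pi.single (mode k i) 1 - Pi.single (mode k i) (-1) = f := fun i => by
    rw [sub_sub, ← Pi.single_add]; simp
  simp only [hf, vacuum_apply]
  split_ifs with h0
  · subst h0
    have ha : a k = ∑ i, if i = k then a k else 0 := by simp
    rw [mul_one, Finset.sum_filter, ha, ← Finset.sum_add_distrib]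
    refine Finset.sum_congr rfl fun i _ => ?_
    have hs : jwSign modePar (mode k i) (0 - Pi.single (mode k i) 1) =
        jwSign modePar (mode k i) (0 : Mode m n → ℤ) := by
      refine (jwSign_sub_single _ _ _ _ (Or.inl rfl)).trans ?_
      simp
    have h1 : (0 - Pi.single (mode k i) 1 : Mode m n → ℤ) (mode k i) = -1 := by simp
    have h2 := jwSign_mul_self modePar (mode k i) (0 : Mode m n → ℤ)
    rw [hs, h1, Pi.zero_apply, mul_one, mul_mul_mul_comm, h2, one_mul]
    rcases lt_trichotomy k i with h | rfl | h
    · rw [annihilateCoeff_neg_one_of_lt a h]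
      simp [createCoeff, h, h.ne']
    · simp [createCoeff, annihilateCoeff]
    · rw [annihilateCoeff_neg_one_of_gt a h]
      simp [h.asymm, h.ne]
  · simp

/-- The state is supported where all modes `(i, j)` of the column `j` have occupation number
zero. -/
def OffColumn (j : Idx m n) (ψ : Fock m n) : Prop := ∀ f, ψ f ≠ 0 → ∀ i, f (mode i j) = 0

theorem offColumn_vacuum (j : Idx m n) : OffColumn j vacuum := by
  intro f hf i
  rw [vacuum_apply] at hf
  have : f = 0 := by by_contra h; simp [h] at hf
  simp [this]

theorem OffColumn.zero (j : Idx m n) : OffColumn j (0 : Fock m n) := fun _ h => absurd rfl h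

theorem OffColumn.add {j : Idx m n} {ψ χ : Fock m n} (h1 : OffColumn j ψ) (h2 : OffColumn j χ) :
    OffColumn j (ψ + χ) := by
  intro f hf
  by_cases h : ψ f = 0
  · exact h2 f fun h' => hf (by simp [h, h'])
  · exact h1 f h

theorem OffColumn.smul {j : Idx m n} {ψ : Fock m n} (h1 : OffColumn j ψ) (c : ℂ) :
    OffColumn j (c • ψ) :=
  fun f hf => h1 f fun h => hf (by simp [h])

theorem OffColumn.fockGen {a : Idx m n → ℂ} {j p q : Idx m n} (hp : p < j) {ψ : Fock m n}
    (h : OffColumn j ψ) : OffColumn j (fockGen a p q ψ) := by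
  intro f hf i
  rw [fockGen_apply] at hf
  obtain ⟨c, -, hc⟩ := Finset.exists_ne_zero_of_sum_ne_zero hf
  have h1 := h _ (right_ne_zero_of_mul (right_ne_zero_of_mul hc))
  have h2 := right_ne_zero_of_mul (left_ne_zero_of_mul hc)
  simp only [Pi.sub_apply, single_mode_apply] at h1
  rcases eq_or_ne j c with rfl | hjc
  · rcases eq_or_ne p q with rfl | hpq
    · have := h1 i
      split_ifs at this <;> omega
    · have := h1 p
      rw [if_pos ⟨rfl, rfl⟩, if_neg fun h' => hpq h'.1] at this
      have h3 : f (mode p j) = 1 := by omega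
      rw [h3] at h2
      exact absurd (createCoeff_one hp) h2
  · simpa [hjc] using h1 i

/-- The part of the PBW theorem that is needed: a sum `∑ E_{j,i} u_i` over `i < j` determines the
`u_i`, if these do not involve the column `j`. -/
theorem eq_zero_of_sum_fockGen_eq_zero {a : Idx m n → ℂ} {j : Idx m n} {u : Idx m n → Fock m n}
    (hu : ∀ i < j, OffColumn j (u i)) (h : ∑ i with i < j, fockGen a j i (u i) = 0)
    (i : Idx m n) (hi : i < j) : u i = 0 := by
  ext f
  by_contra hf
  have hf0 := hu i hi f hf
  -- the only contribution to this state is that of `Y_{j,j} Z_{i,j}` applied to `u_i` at `f`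
  have h1 := congrFun h (f + Pi.single (mode j j) 1 + Pi.single (mode i j) (-1))
  set F := f + Pi.single (mode j j) 1 + Pi.single (mode i j) (-1) with hF
  have hFjj : F (mode j j) = 1 := by
    simp only [hF, Pi.add_apply, single_mode_apply, hf0]
    simp [hi.ne']
  have hFij : F (mode i j) = -1 := by
    simp only [hF, Pi.add_apply, single_mode_apply, hf0]
    simp [hi.ne]
  have hne : ∀ i' < j, ∀ c, u i' (F - Pi.single (mode j c) 1 - Pi.single (mode i' c) (-1)) ≠ 0 →
      i' = i ∧ c = j := by
    intro i' hi' c hc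
    have h2 := hu i' hi' _ hc
    have h3 := h2 j
    have h4 := h2 i
    simp only [Pi.sub_apply, single_mode_apply, hFjj, hFij, hi.ne, hi'.ne', false_and, if_false,
      true_and] at h3 h4
    constructor
    · by_contra hh
      rw [if_neg fun h' => hh h'.1.symm] at h4
      omega
    · by_contra hh
      rw [if_neg (Ne.symm hh)] at h3
      omega
  rw [Finset.sum_apply, Finset.sum_eq_single i, fockGen_apply, Finset.sum_eq_single j] at h1
  · have h5 : F - Pi.single (mode j j) 1 - Pi.single (mode i j) (-1) = f := by rw [hF]; abel
    have h6 : (F - Pi.single (mode j j) 1 : Mode m n → ℤ) (mode i j) = -1 := by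
      rw [Pi.sub_apply, hFij, single_mode_apply, if_neg fun h' => hi.ne h'.1]; rfl
    rw [h5, h6, createCoeff_self, annihilateCoeff_neg_one_of_lt a hi] at h1
    have hj : ∀ A (g : Mode m n → ℤ), jwSign modePar A g ≠ 0 := fun A g h' => by
      simpa [h'] using jwSign_mul_self modePar A g
    simp only [mul_one, Pi.zero_apply] at h1
    exact mul_ne_zero (hj _ _) (mul_ne_zero (hj _ _) hf) h1
  · intro c _ hc
    have : u i (F - Pi.single (mode j c) 1 - Pi.single (mode i c) (-1)) = 0 := by
      by_contra h'
      exact hc (hne i hi c h').2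
    rw [this]; simp
  · simp
  · intro i' hi' hii
    rw [fockGen_apply]
    refine Finset.sum_eq_zero fun c _ => ?_
    have : u i' (F - Pi.single (mode j c) 1 - Pi.single (mode i' c) (-1)) = 0 := by
      by_contra h'
      exact hii (hne i' (by simpa using hi') c h').1
    rw [this]; simp
  · intro h'; exact absurd (by simpa using hi) h'

/-! ### Verma modules -/

theorem unit_mem_nPlus {i j : Idx m n} (h : i < j) : unit i j ∈ nPlus m n := fun k l hkl => by
  rw [unit, Matrix.single_apply_of_ne]
  rintro ⟨rfl, rfl⟩
  exact hkl h

theorem hwVector_isHighestWeight (lam : Weight m n) : IsHighestWeight lam (hwVector lam) := by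
  constructor
  · intro k
    have h : (ι (unit k k) - algebraMap ℂ (U m n) (lam.eval (unit k k))) ∈ vermaIdeal lam :=
      Submodule.subset_span (Or.inr ⟨unit k k, unit_self_mem_cartan k, rfl⟩)
    have he : lam.eval (unit k k) = lam k := by
      simp [Weight.eval, unit, Matrix.single_apply]
    rw [he] at h
    have h2 : (gen k k : U m n) • hwVector lam = Submodule.Quotient.mk (gen k k) := by
      rw [hwVector, ← Submodule.Quotient.mk_smul, smul_eq_mul, mul_one]
    rw [h2, hwVector, ← Submodule.Quotient.mk_smul, Algebra.smul_def, mul_one]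
    exact (Submodule.Quotient.eq _).2 h
  · intro i j hij
    have h : ι (unit i j) ∈ vermaIdeal lam :=
      Submodule.subset_span (Or.inl ⟨unit i j, unit_mem_nPlus hij, rfl⟩)
    rw [hwVector, ← Submodule.Quotient.mk_smul, smul_eq_mul, mul_one]
    exact (Submodule.Quotient.mk_eq_zero _).2 h

theorem raise_nPlus {V : Type*} [AddCommGroup V] [Module ℂ V] [Module (U m n) V]
    [IsScalarTower ℂ (U m n) V] {v : V} (h : ∀ i j, i < j → (gen i j : U m n) • v = 0) {x : Gl m n}
    (hx : x ∈ nPlus m n) : (ι x : U m n) • v = 0 := by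
  rw [ι_eq_sum, Finset.sum_smul]
  refine Finset.sum_eq_zero fun i _ => ?_
  rw [Finset.sum_smul]
  refine Finset.sum_eq_zero fun j _ => ?_
  by_cases hij : i < j
  · rw [smul_assoc, h i j hij, smul_zero]
  · rw [hx i j hij, zero_smul, zero_smul]

/-- The universal property of the Verma module. -/
theorem exists_hom_of_isHighestWeight {V : Type*} [AddCommGroup V] [Module ℂ V] [Module (U m n) V]
    [IsScalarTower ℂ (U m n) V] {lam : Weight m n} {v : V} (h : IsHighestWeight lam v) :
    ∃ F : Verma lam →ₗ[U m n] V, F (hwVector lam) = v := by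
  refine ⟨(vermaIdeal lam).liftQ (LinearMap.toSpanSingleton (U m n) V v) ?_, ?_⟩
  · rw [vermaIdeal, Submodule.span_le]
    rintro _ (⟨x, hx, rfl⟩ | ⟨x, hx, rfl⟩)
    · simpa using raise_nPlus h.raise hx
    · simp only [SetLike.mem_coe, LinearMap.mem_ker, LinearMap.toSpanSingleton_apply, sub_smul,
        algebraMap_smul]
      rw [h.weight.hasWeight x hx, sub_self]
  · rw [hwVector, Submodule.liftQ_apply]
    simp

/-- The Verma module maps to a Fock module, its highest weight vector to the vacuum. -/
theorem exists_fock_map (lam : Weight m n) :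
    ∃ (a : Idx m n → ℂ) (φ : Verma lam →ₗ[ℂ] Fock m n),
      (∀ i j x, φ ((gen i j : U m n) • x) = fockGen a i j (φ x)) ∧
      φ (hwVector lam) = vacuum := by
  let a : Idx m n → ℂ := fun k => lam k - ∑ i with k < i, if par k = par i then -1 else 1
  let _ : Module (U m n) (Fock m n) := Module.compHom _ (fockRep a).toRingHom
  have hsm : ∀ (u : U m n) (ψ : Fock m n), u • ψ = fockRep a u ψ := fun _ _ => rfl
  have : IsScalarTower ℂ (U m n) (Fock m n) := ⟨fun c u ψ => by
    rw [hsm, hsm, map_smul, LinearMap.smul_apply]⟩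
  have hv : IsHighestWeight lam (vacuum : Fock m n) := by
    constructor
    · intro k
      rw [hsm, fockRep_gen, fockGen_vacuum_self, sub_add_cancel]
    · intro i j hij
      rw [hsm, fockRep_gen, fockGen_vacuum_of_lt a hij]
  obtain ⟨F, hF⟩ := exists_hom_of_isHighestWeight hv
  refine ⟨a, F.restrictScalars ℂ, fun i j x => ?_, hF⟩
  rw [LinearMap.restrictScalars_apply, map_smul, hsm, fockRep_gen]
  rfl

/-! ### Weight spaces are spanned by chains -/

section Chains

variable {V : Type*} [AddCommGroup V] [Module (U m n) V]

/-- The vectors `E_{j,j_p} ⋯ E_{j_1,s} v` with `s < j_1 < ⋯ < j_p < j`, and `v` itself for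
`j = s`. -/
inductive IsChainVec (s : Idx m n) (v : V) : Idx m n → V → Prop
  | nil : IsChainVec s v s v
  | cons {i j : Idx m n} {x : V} (hx : IsChainVec s v i x) (hij : i < j) :
      IsChainVec s v j ((gen j i : U m n) • x)

/-- The product of the `E_{a,b}` for a list of pairs `(a, b)`. -/
noncomputable def word (L : List (Idx m n × Idx m n)) : U m n :=
  (L.map fun p => gen p.1 p.2).prod

/-- The sum of the roots of the letters of a word. -/
def wordWeight (L : List (Idx m n × Idx m n)) : Weight m n :=
  (L.map fun p => basisWeight p.1 - basisWeight p.2).sum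

/-- All letters of the word are lowering operators. -/
def IsLowering (L : List (Idx m n × Idx m n)) : Prop := ∀ p ∈ L, p.2 < p.1

theorem IsChainVec.le {s j : Idx m n} {v x : V} (h : IsChainVec s v j x) : s ≤ j := by
  induction h with
  | nil => exact le_rfl
  | cons _ hij ih => exact ih.trans hij.le

theorem word_append_cons_smul (K L : List (Idx m n × Idx m n)) (a b : Idx m n) (v : V) :
    word (K ++ (a, b) :: L) • v = word K • (gen a b : U m n) • word L • v := by
  simp [word, mul_smul]

variable [Module ℂ V]

/-- The span of the chain vectors from `s` to `j`. -/
def chainSpan (s : Idx m n) (v : V) (j : Idx m n) : Submodule ℂ V :=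
  Submodule.span ℂ {x | IsChainVec s v j x}

variable [IsScalarTower ℂ (U m n) V]

theorem gen_smul_mem_chainSpan {s i j : Idx m n} {v x : V} (hx : x ∈ chainSpan s v i)
    (hij : i < j) : (gen j i : U m n) • x ∈ chainSpan s v j := by
  induction hx using Submodule.span_induction with
  | mem x hx => exact Submodule.subset_span (hx.cons hij)
  | zero => rw [smul_zero]; exact Submodule.zero_mem _
  | add x y _ _ hx hy => rw [smul_add]; exact Submodule.add_mem _ hx hy
  | smul c x _ hx => rw [smul_comm_U]; exact Submodule.smul_mem _ _ hx

/-- A word of weight `e_l - e_s` in lowering operators is, applied to `v`, a combination of chains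
from `s` to `l`: some letter has target `l`, and it can be moved to the left, since the correction
terms are shorter words. -/
theorem word_smul_mem_chainSpan {s : Idx m n} (v : V) (N : ℕ) :
    ∀ L : List (Idx m n × Idx m n), L.length = N → IsLowering L →
      ∀ l, wordWeight L = basisWeight l - basisWeight s → word L • v ∈ chainSpan s v l := by
  induction N using Nat.strong_induction_on with
  | _ N IH =>
  intro L hN hL l hw
  -- moving a letter with target `l` to the left
  have move : ∀ K : List (Idx m n × Idx m n), ∀ j K', (K ++ (l, j) :: K').length = N →
      IsLowering (K ++ (l, j) :: K') → (∀ p ∈ K, p.2 ≠ l) →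
      wordWeight (K ++ (l, j) :: K') = basisWeight l - basisWeight s →
      word (K ++ (l, j) :: K') • v ∈ chainSpan s v l := by
    intro K
    induction K using List.reverseRecOn with
    | nil =>
      intro j K' hlen hlow _ hwt
      rw [List.nil_append] at hlen hlow hwt
      rw [word_append_cons_smul, word, List.map_nil, List.prod_nil, one_smul]
      refine gen_smul_mem_chainSpan ?_ (hlow (l, j) List.mem_cons_self)
      refine IH K'.length (by rw [← hlen]; simp) K' rfl
        (fun p hp => hlow p (List.mem_cons_of_mem _ hp)) j ?_
      rw [wordWeight, List.map_cons, List.sum_cons] at hwt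
      rw [wordWeight]
      linear_combination hwt
    | append_singleton K p ih =>
      obtain ⟨a, b⟩ := p
      intro j K' hlen hlow hsrc hwt
      have hb : b ≠ l := hsrc (a, b) (by simp)
      have hba : b < a := hlow (a, b) (by simp)
      have hjl : j < l := hlow (l, j) (by simp)
      rw [List.append_assoc, List.singleton_append] at hlen hlow hwt ⊢
      have hwd : word (K ++ (a, b) :: (l, j) :: K') • v =
          genSgn a b l j • word (K ++ (l, j) :: (a, b) :: K') • v -
          genSgn a b l j • if a = j then word (K ++ (l, b) :: K') • v else 0 := by
        have e : ∀ (x y x' y' : Idx m n) (K₂ : List (Idx m n × Idx m n)),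
            word (K ++ (x, y) :: (x', y') :: K₂) • v =
              word K • (gen x y : U m n) • (gen x' y' : U m n) • word K₂ • v := by
          intro x y x' y' K₂; simp [word, mul_smul]
        rw [e, e, gen_smul_gen_smul, if_neg hb, smul_add, smul_comm_U, zero_sub, smul_neg,
          smul_comm_U, ← sub_eq_add_neg]
        congr 2
        split_ifs
        · rw [word_append_cons_smul]
        · rw [smul_zero]
      rw [hwd]
      refine Submodule.sub_mem _ (Submodule.smul_mem _ _ (ih j ((a, b) :: K') ?_ ?_ ?_ ?_))
        (Submodule.smul_mem _ _ ?_)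
      · rw [← hlen]; simp
      · intro q hq
        refine hlow q ?_
        simp only [List.mem_append, List.mem_cons] at hq ⊢
        tauto
      · intro q hq; exact hsrc q (by simp [hq])
      · rw [← hwt]
        simp only [wordWeight, List.map_append, List.map_cons, List.sum_append, List.sum_cons]
        ring
      · split_ifs with haj
        · subst haj
          refine IH _ ?_ (K ++ (l, b) :: K') rfl ?_ l ?_
          · rw [← hlen]; simp
          · intro q hq
            simp only [List.mem_append, List.mem_cons] at hq
            rcases hq with hq | rfl | hq
            · exact hlow q (by simp [hq])
            · exact hba.trans hjl
            · exact hlow q (by simp [hq])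
          · rw [← hwt]
            simp only [wordWeight, List.map_append, List.map_cons, List.sum_append, List.sum_cons]
            ring
        · exact Submodule.zero_mem _
  rcases eq_or_ne L [] with rfl | hne
  · have hls : l = s := by
      by_contra h
      have := congrFun hw l
      simp [wordWeight, basisWeight, h] at this
    subst hls
    rw [word, List.map_nil, List.prod_nil, one_smul]
    exact Submodule.subset_span IsChainVec.nil
  · -- the largest target of a letter is `l`
    obtain ⟨p, hp, hmax⟩ : ∃ p ∈ L, ∀ q ∈ L, q.1 ≤ p.1 := by
      obtain ⟨p, hp, h⟩ := L.toFinset.exists_max_image Prod.fst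
        ⟨_, List.mem_toFinset.2 (L.head_mem hne)⟩
      exact ⟨p, List.mem_toFinset.1 hp, fun q hq => h q (List.mem_toFinset.2 hq)⟩
    have hcount : ∀ K : List (Idx m n × Idx m n), (∀ q ∈ K, q.2 ≠ p.1) →
        wordWeight K p.1 = (K.countP fun q => q.1 = p.1 : ℕ) := by
      intro K
      induction K with
      | nil => intro _; simp [wordWeight]
      | cons q K ih =>
        intro h
        have h1 := ih fun q hq => h q (List.mem_cons_of_mem _ hq)
        have h2 := h q List.mem_cons_self
        rw [wordWeight] at h1 ⊢
        rw [List.map_cons, List.sum_cons, Pi.add_apply, h1, List.countP_cons]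
        by_cases hq : q.1 = p.1
        · simp [basisWeight, hq, Ne.symm h2, add_comm]
        · simp [basisWeight, hq, Ne.symm h2, Ne.symm hq]
    have hsrc : ∀ q ∈ L, q.2 ≠ p.1 := fun q hq => ((hL q hq).trans_le (hmax q hq)).ne
    have hpos : 0 < L.countP fun q => q.1 = p.1 := List.countP_pos_iff.2 ⟨p, hp, by simp⟩
    have hl : l = p.1 := by
      by_contra h
      have h1 := hcount L hsrc
      rw [hw, Pi.sub_apply] at h1
      simp only [basisWeight, Pi.single_apply, if_neg (Ne.symm h)] at h1
      obtain ⟨k, hk⟩ := Nat.exists_eq_add_of_lt hpos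
      rw [hk] at h1
      split_ifs at h1
      · have h2 : ((k + 1 + 1 : ℕ) : ℂ) = 0 := by push_cast at h1 ⊢; linear_combination -h1
        exact absurd h2 (Nat.cast_ne_zero.2 (by omega))
      · have h2 : ((k + 1 : ℕ) : ℂ) = 0 := by push_cast at h1 ⊢; linear_combination -h1
        exact absurd h2 (Nat.cast_ne_zero.2 (by omega))
    obtain ⟨K, K', rfl⟩ := List.append_of_mem hp
    have hp' : p = (l, p.2) := by rw [hl]
    rw [hp'] at hN hL hw ⊢
    refine move K p.2 K' hN hL (fun q hq => ?_) hw
    rw [hl]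
    exact hsrc q (by simp [hq])

/-- A module generated by a highest weight vector is spanned by words in lowering operators. -/
theorem smul_mem_span_word {lam : Weight m n} {v : V} (hv : IsHighestWeight lam v) (u : U m n) :
    u • v ∈ Submodule.span ℂ
      {x | ∃ L : List (Idx m n × Idx m n), IsLowering L ∧ x = word L • v} := by
  set N := Submodule.span ℂ
    {x | ∃ L : List (Idx m n × Idx m n), IsLowering L ∧ x = word L • v} with hN
  have hlow : ∀ a b : Idx m n, b < a → ∀ x ∈ N, (gen a b : U m n) • x ∈ N := by
    intro a b hab x hx
    induction hx using Submodule.span_induction with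
    | mem x hx =>
      obtain ⟨L, hL, rfl⟩ := hx
      refine Submodule.subset_span ⟨(a, b) :: L, ?_, by simp [word, mul_smul]⟩
      intro p hp
      rcases List.mem_cons.1 hp with rfl | hp
      · exact hab
      · exact hL p hp
    | zero => rw [smul_zero]; exact Submodule.zero_mem _
    | add x y _ _ hx hy => rw [smul_add]; exact Submodule.add_mem _ hx hy
    | smul c x _ hx => rw [smul_comm_U]; exact Submodule.smul_mem _ _ hx
  have hv0 : v ∈ N := Submodule.subset_span ⟨[], fun p hp => by simp at hp, by simp [word]⟩
  have hgen : ∀ L : List (Idx m n × Idx m n), IsLowering L → ∀ i j : Idx m n,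
      (gen i j : U m n) • word L • v ∈ N := by
    intro L
    induction L with
    | nil =>
      intro _ i j
      rw [word, List.map_nil, List.prod_nil, one_smul]
      rcases lt_trichotomy i j with h | rfl | h
      · rw [hv.raise i j h]; exact N.zero_mem
      · rw [hv.weight i]; exact N.smul_mem _ hv0
      · exact hlow i j h v hv0
    | cons p L ih =>
      obtain ⟨a, b⟩ := p
      intro hL i j
      have hL' : IsLowering L := fun q hq => hL q (List.mem_cons_of_mem _ hq)
      have e : word ((a, b) :: L) • v = (gen a b : U m n) • word L • v := by
        simp [word, mul_smul]
      rw [e, gen_smul_gen_smul]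
      refine N.add_mem (N.smul_mem _ (hlow a b (hL (a, b) List.mem_cons_self) _ (ih hL' i j)))
        (N.sub_mem ?_ (N.smul_mem _ ?_))
      · split_ifs
        · exact ih hL' i b
        · exact N.zero_mem
      · split_ifs
        · exact ih hL' a j
        · exact N.zero_mem
  refine smul_mem_of_gen_smul_mem (N := N) (fun i j x hx => ?_) u hv0
  induction hx using Submodule.span_induction with
  | mem x hx =>
    obtain ⟨L, hL, rfl⟩ := hx
    exact hgen L hL i j
  | zero => rw [smul_zero]; exact Submodule.zero_mem _
  | add x y _ _ hx hy => rw [smul_add]; exact Submodule.add_mem _ hx hy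
  | smul c x _ hx => rw [smul_comm_U]; exact Submodule.smul_mem _ _ hx

theorem isWeightVec_word_smul {lam : Weight m n} {v : V} (hv : IsWeightVec lam v)
    (L : List (Idx m n × Idx m n)) : IsWeightVec (lam + wordWeight L) (word L • v) := by
  induction L with
  | nil => simpa [word, wordWeight] using hv
  | cons p L ih =>
    have h := ih.gen_smul p.1 p.2
    have e : word (p :: L) • v = (gen p.1 p.2 : U m n) • word L • v := by simp [word, mul_smul]
    rw [e]
    convert h using 1
    rw [wordWeight, List.map_cons, List.sum_cons, wordWeight]
    ring

variable (V) in
/-- The weight space of weight `mu`. -/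
def weightSpace (mu : Weight m n) : Submodule ℂ V where
  carrier := {x | IsWeightVec mu x}
  add_mem' := fun {x y} hx hy k => by rw [smul_add, smul_add, hx k, hy k]
  zero_mem' := fun k => by rw [smul_zero, smul_zero]
  smul_mem' := fun c x hx k => by rw [smul_comm_U, hx k, smul_comm]

theorem iSupIndep_weightSpace : iSupIndep (weightSpace (m := m) (n := n) V) := by
  let f : Idx m n → Module.End ℂ V := fun k =>
    { toFun := fun x => (gen k k : U m n) • x
      map_add' := fun x y => smul_add _ _ _
      map_smul' := fun c x => smul_comm_U _ _ _ }
  have hcomm : ∀ i j, Commute (f i) (f j) := by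
    intro i j
    ext x
    change (gen i i : U m n) • (gen j j : U m n) • x = (gen j j : U m n) • (gen i i : U m n) • x
    have h1 : genSgn i i j j = 1 := by
      have : par i + par i = 0 := CharTwo.add_self_eq_zero _
      simp [genSgn, sgn, this]
    rw [gen_smul_gen_smul, h1]
    by_cases hij : i = j
    · subst hij; simp
    · simp [hij]
  refine (Module.End.independent_iInf_maxGenEigenspace_of_forall_mapsTo f
    fun i j φ => Module.End.mapsTo_maxGenEigenspace_of_comm (hcomm j i) φ).mono ?_
  intro mu x hx
  rw [Submodule.mem_iInf]
  intro k
  exact Module.End.mem_maxGenEigenspace _ _ _ |>.2 ⟨1, by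
    rw [pow_one, LinearMap.sub_apply, sub_eq_zero]
    exact hx k⟩

/-- In a module generated by a highest weight vector `v` of weight `λ`, the vectors of weight
`λ + e_l - e_s` are combinations of chains from `s` to `l`. -/
theorem mem_chainSpan_of_isWeightVec {lam : Weight m n} {v : V} (hv : IsHighestWeight lam v)
    (hgen : ∀ x : V, ∃ u : U m n, x = u • v) {s l : Idx m n} {w : V}
    (hw : IsWeightVec (lam + basisWeight l - basisWeight s) w) : w ∈ chainSpan s v l := by
  set mu := lam + basisWeight l - basisWeight s with hmu
  set K : Submodule ℂ V := ⨆ (nu) (_ : nu ≠ mu), weightSpace V nu with hK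
  have hle : chainSpan s v l ≤ weightSpace V mu := by
    refine Submodule.span_le.2 fun x hx => ?_
    change IsWeightVec _ x
    rw [hmu]
    clear_value mu
    clear hw hmu hK K
    change IsChainVec s v l x at hx
    induction hx with
    | nil => simpa using hv.weight
    | cons _ _ ih =>
      convert ih.gen_smul _ _ using 1
      ring
  have hsup : w ∈ chainSpan s v l ⊔ K := by
    obtain ⟨u, rfl⟩ := hgen w
    refine Submodule.span_le.2 ?_ (smul_mem_span_word hv u)
    rintro _ ⟨L, hL, rfl⟩
    by_cases h : lam + wordWeight L = mu
    · refine Submodule.mem_sup_left (word_smul_mem_chainSpan v _ L rfl hL l ?_)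
      linear_combination h + hmu
    · exact Submodule.mem_sup_right (Submodule.mem_iSup_of_mem _ (Submodule.mem_iSup_of_mem h
        (isWeightVec_word_smul hv.weight L)))
  obtain ⟨x, hx, y, hy, rfl⟩ := Submodule.mem_sup.1 hsup
  have hy' : y ∈ weightSpace V mu := by
    have := Submodule.sub_mem _ (show x + y ∈ weightSpace V mu from hw) (hle hx)
    simpa using this
  have hy0 : y = 0 := by
    have := (iSupIndep_weightSpace (V := V) mu).le_bot ⟨hy', hy⟩
    simpa using this
  rw [hy0, add_zero]
  exact hx

end Chains

/-! ### Uniqueness of the singular vector -/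

section Uniqueness

variable {V : Type*} [AddCommGroup V] [Module (U m n) V]

theorem IsChainVec.eq_or_exists {s j : Idx m n} {v x : V} (h : IsChainVec s v j x) :
    (j = s ∧ x = v) ∨ ∃ i y, i < j ∧ IsChainVec s v i y ∧ x = (gen j i : U m n) • y := by
  cases h with
  | nil => exact Or.inl ⟨rfl, rfl⟩
  | cons hx hij => exact Or.inr ⟨_, _, hij, hx, rfl⟩

variable [Module ℂ V]

theorem mem_chainSpan_self {s : Idx m n} {v x : V} (h : x ∈ chainSpan s v s) :
    ∃ c : ℂ, x = c • v := by
  have h1 : chainSpan s v s ≤ Submodule.span ℂ {v} := by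
    refine Submodule.span_mono fun y hy => ?_
    rcases IsChainVec.eq_or_exists hy with ⟨-, rfl⟩ | ⟨i, _, hi, h2, -⟩
    · rfl
    · exact absurd hi h2.le.not_gt
  obtain ⟨c, hc⟩ := Submodule.mem_span_singleton.1 (h1 h)
  exact ⟨c, hc.symm⟩

variable {a : Idx m n → ℂ} {φ : V →ₗ[ℂ] Fock m n} {v : V}

theorem offColumn_of_mem_chainSpan
    (hφ : ∀ i j x, φ ((gen i j : U m n) • x) = fockGen a i j (φ x))
    (hv : φ v = vacuum) {s i j : Idx m n} (hij : i < j) {x : V}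
    (hx : x ∈ chainSpan s v i) : OffColumn j (φ x) := by
  induction hx using Submodule.span_induction with
  | mem x hx =>
    change IsChainVec s v i x at hx
    induction hx with
    | nil => rw [hv]; exact offColumn_vacuum j
    | cons _ hi ih => rw [hφ]; exact (ih (hi.trans hij)).fockGen hij
  | zero => rw [map_zero]; exact OffColumn.zero j
  | add x y _ _ hx hy => rw [map_add]; exact hx.add hy
  | smul c x _ hx => rw [map_smul]; exact hx.smul c

variable [IsScalarTower ℂ (U m n) V]

theorem exists_decomposition {s j : Idx m n} {v x : V} (hj : j ≠ s) (hx : x ∈ chainSpan s v j) :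
    ∃ w : Idx m n → V, (∀ i, w i ∈ chainSpan s v i) ∧
      x = ∑ i with i < j, (gen j i : U m n) • w i := by
  induction hx using Submodule.span_induction with
  | mem x hx =>
    rcases IsChainVec.eq_or_exists hx with ⟨h, -⟩ | ⟨i, y, hi, hy, rfl⟩
    · exact absurd h hj
    · refine ⟨Pi.single i y, fun k => ?_, ?_⟩
      · rcases eq_or_ne k i with rfl | hk
        · rw [Pi.single_eq_same]; exact Submodule.subset_span hy
        · rw [Pi.single_eq_of_ne hk]; exact Submodule.zero_mem _
      · rw [Finset.sum_eq_single i, Pi.single_eq_same]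
        · intro k _ hk; rw [Pi.single_eq_of_ne hk, smul_zero]
        · intro h; exact absurd (by simpa using hi) h
  | zero => exact ⟨0, fun _ => Submodule.zero_mem _, by simp⟩
  | add x y _ _ hx hy =>
    obtain ⟨w, hw, rfl⟩ := hx
    obtain ⟨w', hw', rfl⟩ := hy
    exact ⟨w + w', fun i => Submodule.add_mem _ (hw i) (hw' i), by
      simp [smul_add, Finset.sum_add_distrib]⟩
  | smul c x _ hx =>
    obtain ⟨w, hw, rfl⟩ := hx
    exact ⟨c • w, fun i => Submodule.smul_mem _ _ (hw i), by
      simp [smul_comm_U, Finset.smul_sum]⟩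

/-- The decomposition of the partial sums; the coefficient vectors do not depend on the target
`l`. -/
theorem exists_decomposition_partialSum (c : Idx m n → ℂ) {s : Idx m n} (v : V) {j : Idx m n}
    (hj : s ≤ j) : partialVec c s v j ∈ chainSpan s v j ∧
      (s < j → ∃ g : Idx m n → V, (∀ i, g i ∈ chainSpan s v i) ∧
        (∀ i, i ⋖ j → g i = partialVec c s v i) ∧
        ∀ l, partialSum c s j l • v = ∑ i with i < j, (gen l i : U m n) • g i) := by
  refine covBy_induction (s := s) (P := fun j => partialVec c s v j ∈ chainSpan s v j ∧
      (s < j → ∃ g : Idx m n → V, (∀ i, g i ∈ chainSpan s v i) ∧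
        (∀ i, i ⋖ j → g i = partialVec c s v i) ∧
        ∀ l, partialSum c s j l • v = ∑ i with i < j, (gen l i : U m n) • g i)) ?_ ?_ hj
  · rw [partialVec_self]
    exact ⟨Submodule.subset_span IsChainVec.nil, fun h => absurd h (lt_irrefl _)⟩
  · intro i j hi hij ih
    have hset : (Finset.univ.filter fun k => k < j) =
        insert i (Finset.univ.filter fun k => k < i) := by
      ext k
      simp only [Finset.mem_filter, Finset.mem_univ, true_and, Finset.mem_insert]
      rw [hij.lt_iff_le_left, le_iff_eq_or_lt]
    obtain ⟨g, hg, hgl⟩ : ∃ g : Idx m n → V, (∀ k, g k ∈ chainSpan s v k) ∧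
        ∀ l, (if i = s then 0 else c i • partialSum c s i l • v) =
          ∑ k with k < i, (gen l k : U m n) • g k := by
      rcases hi.eq_or_lt with rfl | hi
      · exact ⟨0, fun _ => Submodule.zero_mem _, fun l => by simp⟩
      · obtain ⟨g, hg, -, hgl⟩ := ih.2 hi
        refine ⟨c i • g, fun k => Submodule.smul_mem _ _ (hg k), fun l => ?_⟩
        rw [if_neg hi.ne', hgl, Finset.smul_sum]
        exact Finset.sum_congr rfl fun k _ => (smul_comm_U _ _ _).symm
    have hdec : ∀ l, partialSum c s j l • v = ∑ k with k < j,
        (gen l k : U m n) • Function.update g i (partialVec c s v i) k := by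
      intro l
      rw [partialSum_smul_of_covBy l hi hij, hgl, hset, Finset.sum_insert (by simp),
        Function.update_self]
      congr 1
      refine Finset.sum_congr rfl fun k hk => ?_
      rw [Function.update_of_ne (Finset.mem_filter.1 hk).2.ne]
    have hmem : ∀ k, Function.update g i (partialVec c s v i) k ∈ chainSpan s v k := by
      intro k
      rcases eq_or_ne k i with rfl | hk
      · rw [Function.update_self]; exact ih.1
      · rw [Function.update_of_ne hk]; exact hg k
    refine ⟨?_, fun _ => ⟨_, hmem, fun k hk => ?_, hdec⟩⟩
    · rw [partialVec_of_lt (hi.trans_lt hij.lt), hdec]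
      exact Submodule.sum_mem _ fun k hk =>
        gen_smul_mem_chainSpan (hmem k) (Finset.mem_filter.1 hk).2
    · rw [hk.unique_left hij, Function.update_self]

/-- The map to the Fock module is injective on combinations of chains. -/
theorem eq_zero_of_map_eq_zero
    (hφ : ∀ i j x, φ ((gen i j : U m n) • x) = fockGen a i j (φ x))
    (hv : φ v = vacuum) {s j : Idx m n} {x : V}
    (hx : x ∈ chainSpan s v j) (h0 : φ x = 0) : x = 0 := by
  induction j using WellFoundedLT.induction generalizing x with
  | ind j ih =>
    rcases eq_or_ne j s with rfl | hj
    · obtain ⟨c, rfl⟩ := mem_chainSpan_self hx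
      rw [map_smul, hv] at h0
      have := congrFun h0 0
      rw [Pi.smul_apply, vacuum_apply, if_pos rfl] at this
      have hc : c = 0 := by simpa using this
      rw [hc, zero_smul]
    · obtain ⟨w, hw, rfl⟩ := exists_decomposition hj hx
      simp only [map_sum, hφ] at h0
      refine Finset.sum_eq_zero fun i hi => ?_
      have hi' : i < j := (Finset.mem_filter.1 hi).2
      rw [ih i hi' (hw i) (eq_zero_of_sum_fockGen_eq_zero (u := fun i => φ (w i))
        (fun k hk => offColumn_of_mem_chainSpan hφ hv hk (hw k)) h0 i hi'), smul_zero]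

/-- The equations that `E_{b,b'} x = 0` in the Fock module imposes on the components `w i` of
`x`, for `b < b' < j`. -/
theorem raise_components
    (hφ : ∀ i j x, φ ((gen i j : U m n) • x) = fockGen a i j (φ x))
    (hv : φ v = vacuum) {s j b b' : Idx m n} (hb : b < b') (hb' : b' < j)
    {w : Idx m n → V} (hw : ∀ i, w i ∈ chainSpan s v i)
    (h0 : φ ((gen b b' : U m n) • ∑ i with i < j, (gen j i : U m n) • w i) = 0) (i : Idx m n)
    (hi : i < j) :
    genSgn b b' j i • φ ((gen b b' : U m n) • w i) =
      if i = b' then genSgn b b' j b • φ (w b) else 0 := by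
  have hbj := hb.trans hb'
  have key : φ ((gen b b' : U m n) • ∑ i with i < j, (gen j i : U m n) • w i) =
      ∑ i with i < j, fockGen a j i (genSgn b b' j i • φ ((gen b b' : U m n) • w i) -
        if i = b' then genSgn b b' j b • φ (w b) else 0) := by
    have e1 : ∀ i, (gen b b' : U m n) • (gen j i : U m n) • w i =
        genSgn b b' j i • (gen j i : U m n) • (gen b b' : U m n) • w i -
          if b = i then genSgn b b' j b • (gen j b' : U m n) • w b else 0 := by
      intro i
      rw [gen_smul_gen_smul, if_neg hb'.ne, zero_sub, ← sub_eq_add_neg]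
      congr 1
      split_ifs with h
      · rw [h]
      · rw [smul_zero]
    have e2 : ∀ i, fockGen a j i (if i = b' then genSgn b b' j b • φ (w b) else 0) =
        if i = b' then genSgn b b' j b • fockGen a j b' (φ (w b)) else 0 := by
      intro i
      split_ifs with h
      · rw [h, map_smul]
      · rw [map_zero]
    simp only [Finset.smul_sum, e1, map_sum, map_sub, Finset.sum_sub_distrib, e2]
    congr 1
    · refine Finset.sum_congr rfl fun i _ => ?_
      rw [φ.map_smul, hφ j i, LinearMap.map_smul]
    · rw [Finset.sum_ite_eq', if_pos (by simpa using hb'), Finset.sum_eq_single b, if_pos rfl,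
        map_smul, hφ]
      · intro i _ hi; rw [if_neg hi.symm, map_zero]
      · intro h; exact absurd (by simpa using hbj) h
  rw [key] at h0
  refine sub_eq_zero.1 (eq_zero_of_sum_fockGen_eq_zero (fun k hk => ?_) h0 i hi)
  have h1 := ((offColumn_of_mem_chainSpan hφ hv hk (hw k)).fockGen (a := a) (q := b') hbj).smul
    (genSgn b b' j k)
  rw [← hφ] at h1
  have h2 : OffColumn j (-if k = b' then genSgn b b' j b • φ (w b) else 0) := by
    split_ifs
    · rw [← neg_one_smul ℂ]
      exact ((offColumn_of_mem_chainSpan hφ hv hbj (hw b)).smul _).smul _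
    · rw [neg_zero]; exact OffColumn.zero j
  rw [sub_eq_add_neg]
  exact h1.add h2

/-- A combination of chains from `s` to `j` killed by all simple raising operators `E_{b,b'}` with
`b' < j` is a multiple of `S_j v`: its component at the index before `j` is a multiple of the
preceding partial sum by induction, and determines the others. -/
theorem eq_smul_partialVec
    (hφ : ∀ i j x, φ ((gen i j : U m n) • x) = fockGen a i j (φ x))
    {lam : Weight m n} (hlam : IsHighestWeight lam v) (hv : φ v = vacuum)
    {c : Idx m n → ℂ} {s : Idx m n} (hc : IsAdapted c s lam) {j : Idx m n} (hj : s ≤ j) :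
    ∀ w ∈ chainSpan s v j,
      (∀ b b', b ⋖ b' → b' < j → φ ((gen b b' : U m n) • w) = 0) →
      ∃ y : ℂ, w = y • partialVec c s v j := by
  refine covBy_induction (s := s) (P := fun j => ∀ w ∈ chainSpan s v j,
      (∀ b b', b ⋖ b' → b' < j → φ ((gen b b' : U m n) • w) = 0) →
      ∃ y : ℂ, w = y • partialVec c s v j) ?_ ?_ hj
  · intro w hw _
    rw [partialVec_self]
    exact mem_chainSpan_self hw
  · intro i j hi hij ih x hx h0
    have hsj := hi.trans_lt hij.lt
    obtain ⟨w, hw, rfl⟩ := exists_decomposition hsj.ne' hx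
    obtain ⟨y, hy⟩ := ih (w i) (hw i) fun b b' hb hb' => by
      have h1 := raise_components hφ hv hb.lt (hb'.trans hij.lt) hw
        (h0 b b' hb (hb'.trans hij.lt)) i hij.lt
      rw [if_neg hb'.ne'] at h1
      exact (smul_eq_zero.1 h1).resolve_left (genSgn_ne_zero _ _ _ _)
    obtain ⟨hmem, hdec⟩ := exists_decomposition_partialSum c v hsj.le
    obtain ⟨g, hg, hgi, hgl⟩ := hdec hsj
    -- the difference with the multiple of `S_j v` has a vanishing component at `i`
    refine ⟨y, sub_eq_zero.1 ?_⟩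
    set w' : Idx m n → V := fun k => w k - y • g k with hw'
    have hw'mem : ∀ k, w' k ∈ chainSpan s v k := fun k =>
      Submodule.sub_mem _ (hw k) (Submodule.smul_mem _ _ (hg k))
    have heq : ∑ k with k < j, (gen j k : U m n) • w k - y • partialVec c s v j =
        ∑ k with k < j, (gen j k : U m n) • w' k := by
      rw [partialVec_of_lt hsj, hgl, Finset.smul_sum, ← Finset.sum_sub_distrib]
      refine Finset.sum_congr rfl fun k _ => ?_
      rw [hw', smul_sub, smul_comm_U]
    have h0' : ∀ b b', b ⋖ b' → b' < j →
        φ ((gen b b' : U m n) • ∑ k with k < j, (gen j k : U m n) • w' k) = 0 := by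
      intro b b' hb hb'
      rw [← heq, smul_sub, map_sub, h0 b b' hb hb', smul_comm_U, partialVec_of_lt hsj,
        (raiseRules hlam hc hsj).zero j b b' le_rfl hb hb'.ne hb'.ne]
      simp
    -- hence all its components vanish, from `i` downwards
    have hzero : ∀ k, k ≤ i → φ (w' k) = 0 := by
      intro k hk
      induction k using WellFoundedGT.induction with
      | ind k ihk =>
        rcases hk.eq_or_lt with rfl | hlt
        · rw [hw']
          simp only
          rw [hy, hgi k hij, sub_self, map_zero]
        · obtain ⟨k', hk', hle⟩ := exists_covBy_le_of_lt hlt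
          have hk'j := hle.trans_lt hij.lt
          have h1 := raise_components hφ hv hk'.lt hk'j hw'mem (h0' k k' hk' hk'j) k' hk'j
          rw [if_pos rfl, hφ, ihk k' hk'.lt hle, map_zero, smul_zero] at h1
          exact (smul_eq_zero.1 h1.symm).resolve_left (genSgn_ne_zero _ _ _ _)
    rw [heq]
    refine Finset.sum_eq_zero fun k hk => ?_
    have hkj : k < j := (Finset.mem_filter.1 hk).2
    rw [eq_zero_of_map_eq_zero hφ hv (hw'mem k) (hzero k (hij.lt_iff_le_left.1 hkj)), smul_zero]

theorem partialVec_ne_zero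
    (hφ : ∀ i j x, φ ((gen i j : U m n) • x) = fockGen a i j (φ x))
    (hv : φ v = vacuum) (c : Idx m n → ℂ) {s j : Idx m n} (hj : s ≤ j) :
    partialVec c s v j ≠ 0 := by
  refine covBy_induction (s := s) (P := fun j => partialVec c s v j ≠ 0) ?_ ?_ hj
  · rw [partialVec_self]
    rintro rfl
    have := congrFun hv 0
    rw [vacuum_apply, if_pos rfl] at this
    simp at this
  · intro i j hi hij ih h0
    have hsj := hi.trans_lt hij.lt
    obtain ⟨-, hdec⟩ := exists_decomposition_partialSum c v hsj.le
    obtain ⟨g, hg, hgi, hgl⟩ := hdec hsj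
    rw [partialVec_of_lt hsj, hgl] at h0
    have h1 := congrArg φ h0
    simp only [map_sum, hφ, map_zero] at h1
    have h2 := eq_zero_of_sum_fockGen_eq_zero (u := fun i => φ (g i))
      (fun k hk => offColumn_of_mem_chainSpan hφ hv hk (hg k)) h1 i hij.lt
    exact ih (hgi i hij ▸ eq_zero_of_map_eq_zero hφ hv (hg i) h2)

end Uniqueness

theorem exists_smul_hwVector {lam : Weight m n} (x : Verma lam) :
    ∃ u : U m n, x = u • hwVector lam := by
  obtain ⟨u, rfl⟩ := Submodule.Quotient.mk_surjective _ x
  refine ⟨u, ?_⟩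
  rw [hwVector, ← Submodule.Quotient.mk_smul, smul_eq_mul, mul_one]

end GLSuper

open GLSuper in
theorem theorem2p1 (m n : ℕ) (s : Fin m) (t : Fin n) (lam : GLSuper.Weight m n)
    (hlam : GLSuper.IsAtypical lam (GLSuper.oddRoot s t)) :
    (GLSuper.IsSingular m n (GLSuper.elemS lam s t • GLSuper.hwVector lam) ∧
      GLSuper.HasWeight (lam - GLSuper.oddRoot s t)
        (GLSuper.elemS lam s t • GLSuper.hwVector lam)) ∧
    (∀ w : GLSuper.Verma lam, GLSuper.IsSingular m n w →
      GLSuper.HasWeight (lam - GLSuper.oddRoot s t) w →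
      ∃ c : ℂ, c ≠ 0 ∧ w = c • (GLSuper.elemS lam s t • GLSuper.hwVector lam)) ∧
    Nonempty ((GLSuper.Verma (lam - GLSuper.oddRoot s t) →ₗ[GLSuper.U m n] GLSuper.Verma lam)
      ≃ₗ[ℂ] ℂ) := by
  obtain ⟨a, φ, hφ, hφv⟩ := exists_fock_map lam
  have hv := hwVector_isHighestWeight lam
  have hc := isAdapted_coeffC hlam
  have hst : (bar s : Idx m n) < pos t := bar_lt_pos s t
  have hmu : lam - oddRoot s t = lam + basisWeight (pos t) - basisWeight (bar s) := by
    rw [oddRoot]; ring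
  have hS : elemS lam s t • hwVector lam =
      partialVec (coeffC lam s t) (bar s) (hwVector lam) (pos t) := by
    rw [elemS_eq_partialSum, partialVec_of_lt hst]
  have hne : elemS lam s t • hwVector lam ≠ 0 := by
    rw [hS]; exact partialVec_ne_zero hφ hφv _ hst.le
  have hhw : IsHighestWeight (lam - oddRoot s t) (elemS lam s t • hwVector lam) := by
    constructor
    · rw [hS, hmu]; exact hv.partialVec hst.le
    · intro i j hij
      rw [elemS_eq_partialSum]
      exact raise_partialSum hv hc hst (coeffC_pos_self lam s t) i j hij
  have huniq : ∀ w : Verma lam, IsHighestWeight (lam - oddRoot s t) w →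
      ∃ c : ℂ, w = c • (elemS lam s t • hwVector lam) := by
    intro w hw
    rw [hS]
    refine eq_smul_partialVec hφ hv hφv hc hst.le w ?_ ?_
    · exact mem_chainSpan_of_isWeightVec hv exists_smul_hwVector (hmu ▸ hw.weight)
    · intro b b' hb _
      rw [hw.raise b b' hb.lt, map_zero]
  refine ⟨⟨⟨hne, fun x hx => raise_nPlus hhw.raise hx⟩, hhw.weight.hasWeight⟩, ?_, ?_⟩
  · intro w hw hwt
    obtain ⟨c, hc⟩ := huniq w ⟨hwt.isWeightVec, fun i j hij => hw.2 _ (unit_mem_nPlus hij)⟩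
    refine ⟨c, ?_, hc⟩
    rintro rfl
    exact hw.1 (hc.trans (zero_smul ℂ (elemS lam s t • hwVector lam)))
  · -- a homomorphism is determined by the image of the highest weight vector
    obtain ⟨F, hF⟩ := exists_hom_of_isHighestWeight hhw
    have hv' := hwVector_isHighestWeight (lam - oddRoot s t)
    have hext : ∀ G H : Verma (lam - oddRoot s t) →ₗ[U m n] Verma lam,
        G (hwVector _) = H (hwVector _) → G = H := by
      intro G H h
      refine LinearMap.ext fun x => ?_
      obtain ⟨u, rfl⟩ := exists_smul_hwVector x
      rw [map_smul, map_smul, h]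
    refine ⟨(LinearEquiv.ofBijective (LinearMap.toSpanSingleton ℂ _ F) ⟨?_, ?_⟩).symm⟩
    · rw [← LinearMap.ker_eq_bot, LinearMap.ker_eq_bot']
      intro c hc
      have h1 := congrArg (fun G => G (hwVector _)) hc
      simp only [LinearMap.toSpanSingleton_apply, LinearMap.smul_apply, hF,
        LinearMap.zero_apply] at h1
      exact (smul_eq_zero.1 h1).resolve_right hne
    · intro G
      obtain ⟨c, hc⟩ := huniq (G (hwVector _)) (by
        constructor
        · intro k
          rw [← map_smul, hv'.weight k]
          exact (G.restrictScalars ℂ).map_smul _ _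
        · intro i j hij
          rw [← map_smul, hv'.raise i j hij, map_zero])
      refine ⟨c, hext _ _ ?_⟩
      rw [LinearMap.toSpanSingleton_apply, LinearMap.smul_apply, hF, hc]
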